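/- Let $(\Sigma, dh)$ be a smooth Riemannian surface, with Gaussian curvature $\kappa$ (not assumed constant). Its magnetic Lorentzian extension is the unit tangent bundle $V = S^1(T\Sigma)$ with the Lorentzian metric $dg = dh \oplus (-d\theta^2)$ for the splitting $T_{(\sigma,v)}V = H_{(\sigma,v)} \oplus T_v S^1(T_\sigma\Sigma)$ into horizontal vectors for the Levi-Civita connection of $dh$ (with $H_{(\sigma,v)} \cong T_\sigma\Sigma$) and vertical vectors, where $d\theta^2$ is the canonical metric of the unit circle $S^1(T_\sigma\Sigma)$. A null-geodesic of $V$ is a smooth curve $\Gamma : I \to V$ on an open interval with $\nabla_{\dot\Gamma}\dot\Gamma = 0$ for the Levi-Civita connection $\nabla$ of $dg$ and $dg(\dot\Gamma, \dot\Gamma) = 0$. 1) The projection $\gamma$ to $\Sigma$ of any null-geodesic $\Gamma$ has constant speed. For the rest, consider an open subset $U \subseteq \Sigma$ with an orientation ($U = \Sigma$ if $\Sigma$ is oriented); let $J$ be the rotation of tangent vectors by a right angle in the positive direction. On $V|_U$ let $X$ and $Y$ be the horizontal fields which at $(\sigma, v)$ are the horizontal lifts of $v$ and $Jv$, and let $Z$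 be the positive unit field tangent to the fibres. For $\theta \in S^1$ put $X(\theta) = \cos\theta\, X + \sin\theta\, Y$. On $V|_U \times S^1$ consider the fields $\tilde X = X(\theta)$ and $\tilde Z = Z$ (on $V|_U\times\{\theta\}$), $\Theta = \partial/\partial\theta$, and $$W = \tilde X + \tilde Z - (1 + \kappa)\,\Theta .$$ 2) For each $p \in V|_U$, the map $\theta \mapsto \langle X(\theta) + Z \rangle$ is a bijection from $S^1$ onto the set $NC(T_pV)$ of null lines in $T_pV$. This identifies $V|_U \times S^1$ with $NC(TV|_U)$. 3) Let $\Gamma$ be a null-geodesic in $V|_U$ that is not constant, and $\gamma$ its projection. There is a constant $r \neq 0$ such that the natural lift $t \mapsto (\Gamma(t), \langle\dot\Gamma(t)\rangle)$ of $\Gamma$ to $NC(TV) = V \times S^1$ is an integral curve of $rW$; in particular $\dot\Gamma = r\,(X(\theta) + Z)$ for a function $\theta$ of $t$. The speed of $\gamma$ is $|r|$. If $r > 0$ (that is, if $\Gamma$ moves in the direction of $Z$), the geodesic curvature of $\gamma$ is $-\kappa(\gamma(t))$; if $r < 0$, it is $\kappa(\gamma(t))$. 4) Conversely, if $r \neq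 0$ is a constant, every integral curve of $rW$ (with smooth component in $V$) projects to a null-geodesic $\Gamma$ of $V$, of which it is the natural lift. -/

import Mathlib

open scoped Manifold ContDiff Topology Bundle

noncomputable section

namespace MagneticExtension

/-! ### Pseudo-Riemannian calculus in one coordinate system

`G x` is the metric tensor at the point `x` of the coordinate space `F`. -/

section Coordinates

variable {F : Type*} [NormedAddCommGroup F] [NormedSpace ℝ F]

/-- The Christoffel symbols of the first kind, `(v, w) ↦ christoffelLower G x u v w`,
see `christoffelLower_apply`. -/
def christoffelLower (G : F → F →L[ℝ] F →L[ℝ] ℝ) (x u : F) : F →L[ℝ] F →L[ℝ] ℝ :=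
  (1 / 2 : ℝ) • (fderiv ℝ G x u + (fderiv ℝ G x).flip u - ((fderiv ℝ G x).flip u).flip)

theorem christoffelLower_apply (G : F → F →L[ℝ] F →L[ℝ] ℝ) (x u v w : F) :
    christoffelLower G x u v w
      = 1 / 2 * (fderiv ℝ G x u v w + fderiv ℝ G x v u w - fderiv ℝ G x w u v) := by
  rfl

/-- The Christoffel symbols `v ↦ Γ_x(u, v)` of the Levi-Civita connection of `G`, characterized by
`christoffel_spec`. -/
def christoffel (G : F → F →L[ℝ] F →L[ℝ] ℝ) (x u : F) : F →L[ℝ] F :=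
  (G x).inverse.comp (christoffelLower G x u)

theorem christoffel_spec (G : F → F →L[ℝ] F →L[ℝ] ℝ) (x u v w : F) (hG : (G x).IsInvertible) :
    G x (christoffel G x u v) w
      = 1 / 2 * (fderiv ℝ G x u v w + fderiv ℝ G x v u w - fderiv ℝ G x w u v) := by
  obtain ⟨A, hA⟩ := hG
  rw [← christoffelLower_apply]
  simp [christoffel, ← hA]

/-- The covariant acceleration `∇_{c'} c' = c'' + Γ_c(c', c')` of a curve `c`. -/
def acceleration (G : F → F →L[ℝ] F →L[ℝ] ℝ) (c : ℝ → F) (t : ℝ) : F :=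
  deriv (deriv c) t + christoffel G (c t) (deriv c t) (deriv c t)

/-- The curvature tensor `R(u, v)w = ∇_u ∇_v w - ∇_v ∇_u w` (`u`, `v`, `w` constant fields). -/
def riemann (G : F → F →L[ℝ] F →L[ℝ] ℝ) (x u v w : F) : F :=
  fderiv ℝ (fun y => christoffel G y v w) x u - fderiv ℝ (fun y => christoffel G y u w) x v
    + christoffel G x u (christoffel G x v w) - christoffel G x v (christoffel G x u w)

/-- The vertical part, for the Levi-Civita connection of `G`, of a vector `ξ` tangent to the tangent
bundle at `(y, w)`, in the coordinates `(y, w)` induced by those of the base. If `ξ` is the velocity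
`(c', w')` of a vector field `w` along a curve `c` in the base, this is the covariant derivative
`w' + Γ_c(c', w)` of that field (recall that `Γ_y(u, w) = Γ_y(w, u)`, as `G` is symmetric).
The horizontal part of `ξ` is identified with its projection `ξ.1` to the base. -/
def verticalPart (G : F → F →L[ℝ] F →L[ℝ] ℝ) (y w : F) : F × F →L[ℝ] F :=
  ContinuousLinearMap.snd ℝ F F
    + (christoffel G y w).comp (ContinuousLinearMap.fst ℝ F F)

/-- The bilinear form `dh ⊕ (- dh)` on the tangent space to the tangent bundle at `(y, w)`, for
the splitting into horizontal and vertical vectors. Restricted to the tangent space of the unit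
tangent bundle it is the magnetic Lorentzian metric `dh ⊕ (- dθ²)`, since the canonical metric `dθ²`
of a unit circle in a tangent plane is the restriction of `dh` to its tangent lines. -/
def splitForm (G : F → F →L[ℝ] F →L[ℝ] ℝ) (y w : F) : F × F →L[ℝ] F × F →L[ℝ] ℝ :=
  (G y).bilinearComp (ContinuousLinearMap.fst ℝ F F) (ContinuousLinearMap.fst ℝ F F)
    - (G y).bilinearComp (verticalPart G y w) (verticalPart G y w)

end Coordinates

/-! ### Coordinates on the unit tangent bundle of a surface -/

/-- The coordinate plane. -/
abbrev Plane := EuclideanSpace ℝ (Fin 2)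

/-- First vector of the orthonormal frame obtained from the coordinate frame by Gram-Schmidt. -/
def frameOne (G : Plane → Plane →L[ℝ] Plane →L[ℝ] ℝ) (y : Plane) : Plane :=
  let e₁ : Plane := !₂[1, 0]
  (√(G y e₁ e₁))⁻¹ • e₁

/-- Second vector of the orthonormal frame obtained from the coordinate frame by Gram-Schmidt. -/
def frameTwo (G : Plane → Plane →L[ℝ] Plane →L[ℝ] ℝ) (y : Plane) : Plane :=
  let e₂ : Plane := !₂[0, 1]
  let n : Plane := e₂ - G y e₂ (frameOne G y) • frameOne G y
  (√(G y n n))⁻¹ • n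

/-- The unit vector at `y` making the angle `α` with the first vector of the frame. -/
def unitVector (G : Plane → Plane →L[ℝ] Plane →L[ℝ] ℝ) (q : Plane × ℝ) : Plane :=
  Real.cos q.2 • frameOne G q.1 + Real.sin q.2 • frameTwo G q.1

/-- The magnetic Lorentzian metric in the coordinates `(y, α)` of the unit tangent bundle: the
pullback of `splitForm` by `(y, α) ↦ (y, unitVector G (y, α))`. -/
def magneticMetric (G : Plane → Plane →L[ℝ] Plane →L[ℝ] ℝ) (q : Plane × ℝ) :
    Plane × ℝ →L[ℝ] Plane × ℝ →L[ℝ] ℝ :=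
  let T : Plane × ℝ →L[ℝ] Plane × Plane :=
    (ContinuousLinearMap.fst ℝ Plane ℝ).prod (fderiv ℝ (unitVector G) q)
  (splitForm G q.1 (unitVector G q)).bilinearComp T T

/-! ### Riemannian surfaces -/

section Surface

variable {S : Type*} [TopologicalSpace S] [ChartedSpace Plane S] [IsManifold (𝓡 2) ∞ S]

variable (S) in
/-- A smooth Riemannian metric `dh` on the surface `S`. -/
abbrev SurfaceMetric :=
  Bundle.ContMDiffRiemannianMetric (𝓡 2) ∞ Plane (fun x : S => TangentSpace (𝓡 2) x)

/-- The metric tensor in the preferred chart at `x₀`. Here `symmL` sends coordinates with respect to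
the coordinate frame of that chart to tangent vectors. -/
def chartMetric (h : SurfaceMetric S) (x₀ : S) (y : Plane) : Plane →L[ℝ] Plane →L[ℝ] ℝ :=
  let x : S := (extChartAt (𝓡 2) x₀).symm y
  let A : Plane →L[ℝ] Plane := (trivializationAt Plane (TangentSpace (𝓡 2)) x₀).symmL ℝ x
  let B : Plane →L[ℝ] Plane →L[ℝ] ℝ := h.inner x
  B.bilinearComp A A

/-- The Gaussian curvature `κ`. -/
def gaussCurvature (h : SurfaceMetric S) (x : S) : ℝ :=
  let G := chartMetric h x
  let y := extChartAt (𝓡 2) x x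
  let e₁ : Plane := !₂[1, 0]
  let e₂ : Plane := !₂[0, 1]
  G y (riemann G y e₁ e₂ e₂) e₁ / (G y e₁ e₁ * G y e₂ e₂ - G y e₁ e₂ ^ 2)

/-- The velocity of a curve in `S`. -/
def velocity (γ : ℝ → S) (t : ℝ) : TangentSpace (𝓡 2) (γ t) :=
  mfderiv 𝓘(ℝ, ℝ) (𝓡 2) γ t (1 : ℝ)

/-- The speed `‖γ'‖` of a curve in `S`. -/
def speed (h : SurfaceMetric S) (γ : ℝ → S) (t : ℝ) : ℝ :=
  √(h.inner (γ t) (velocity γ t) (velocity γ t))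

/-- The covariant acceleration `∇_{γ'} γ'` at time `t` of a curve in `S`, computed in the preferred
chart at `γ t` (the tangent space at `γ t` is the coordinate space of that chart). -/
def curveAcceleration (h : SurfaceMetric S) (γ : ℝ → S) (t : ℝ) : Plane :=
  acceleration (chartMetric h (γ t)) (fun s => extChartAt (𝓡 2) (γ t) (γ s)) t

/-- An orientation of the open subset `U` of `S`, given as the field `J` of rotations by a right
angle in the positive direction, which is isometric and continuous. -/
structure OrientationOn (h : SurfaceMetric S) (U : Set S) where
  J : ∀ x : S, TangentSpace (𝓡 2) x →L[ℝ] TangentSpace (𝓡 2) x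
  J_J : ∀ x ∈ U, ∀ v, J x (J x v) = -v
  isometry : ∀ x ∈ U, ∀ v w, h.inner x (J x v) (J x w) = h.inner x v w
  continuousOn : ContinuousOn
    (fun p : TangentBundle (𝓡 2) S => (⟨p.1, J p.1 p.2⟩ : TangentBundle (𝓡 2) S)) {p | p.1 ∈ U}

/-- The geodesic curvature of a regular curve in `S`, with respect to the orientation `o`:
`⟨∇_{γ'} γ', J γ'⟩ / ‖γ'‖³`. -/
def geodesicCurvature (h : SurfaceMetric S) {U : Set S} (o : OrientationOn h U) (γ : ℝ → S)
    (t : ℝ) : ℝ :=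
  h.inner (γ t) (curveAcceleration h γ t) (o.J (γ t) (velocity γ t)) / speed h γ t ^ 3

/-! ### The magnetic Lorentzian extension

`V` is the submanifold `unitTangent h` of the tangent bundle; its curves and tangent vectors are
curves in, and tangent vectors to, the tangent bundle. Tangent vectors at `p` to the tangent bundle
are elements of `Plane × Plane`, in the coordinates of the preferred chart at `p`, which are those
induced by the preferred chart of `S` at `p.1`. -/

/-- The unit tangent bundle `V = S¹(TS)`. -/
def unitTangent (h : SurfaceMetric S) : Set (TangentBundle (𝓡 2) S) :=
  {p | h.inner p.1 p.2 p.2 = 1}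

/-- The vertical part of a vector tangent to the tangent bundle at `p`. -/
def vertical (h : SurfaceMetric S) (p : TangentBundle (𝓡 2) S) :
    Plane × Plane →L[ℝ] Plane :=
  verticalPart (chartMetric h p.1) (extChartAt (𝓡 2) p.1 p.1) p.2

/-- The tangent space to `V` at `p`: the sum of the horizontal space and of the tangent line to the
unit circle at `p.2`, that is, the vectors with vertical part orthogonal to `p.2`. -/
def unitTangentSpace (h : SurfaceMetric S) (p : TangentBundle (𝓡 2) S) :
    Set (Plane × Plane) :=
  {ξ | h.inner p.1 (vertical h p ξ) p.2 = 0}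

/-- The magnetic Lorentzian metric `dg = dh ⊕ (- dθ²)` at `p ∈ V`. -/
def dg (h : SurfaceMetric S) (p : TangentBundle (𝓡 2) S) :
    Plane × Plane →L[ℝ] Plane × Plane →L[ℝ] ℝ :=
  splitForm (chartMetric h p.1) (extChartAt (𝓡 2) p.1 p.1) p.2

/-- The velocity of a curve in the tangent bundle. -/
def liftVelocity (Γ : ℝ → TangentBundle (𝓡 2) S) (t : ℝ) : Plane × Plane :=
  mfderiv 𝓘(ℝ, ℝ) (𝓡 2).tangent Γ t (1 : ℝ)

/-- The local parametrization `(y, α) ↦ (y, unitVector (y, α))` of `V` over the preferred chart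
at `x₀`. -/
def unitParam (h : SurfaceMetric S) (x₀ : S) (q : Plane × ℝ) : TangentBundle (𝓡 2) S :=
  let x : S := (extChartAt (𝓡 2) x₀).symm q.1
  ⟨x, (trivializationAt Plane (TangentSpace (𝓡 2)) x₀).symmL ℝ x
    (unitVector (chartMetric h x₀) q)⟩

/-- The geodesic equation `∇_{Γ'} Γ' = 0` at time `t` for a curve in `(V, dg)`, written in the
coordinates `(y, α)` of `V` over the preferred chart at the base point of `Γ t`. The angle `α` of
`Γ` is determined up to a constant multiple of `2π`, on which `magneticMetric` does not depend. -/
def GeodesicEquationAt (h : SurfaceMetric S) (Γ : ℝ → TangentBundle (𝓡 2) S) (t : ℝ) : Prop :=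
  ∃ α : ℝ → ℝ, ContDiffAt ℝ ∞ α t ∧
    (∀ᶠ s in 𝓝 t, Γ s = unitParam h (Γ t).1 (extChartAt (𝓡 2) (Γ t).1 (Γ s).1, α s)) ∧
    acceleration (magneticMetric (chartMetric h (Γ t).1))
      (fun s => (extChartAt (𝓡 2) (Γ t).1 (Γ s).1, α s)) t = 0

/-- `Γ` is, on the open set `I` of times, a smooth curve in `V` over the subset `U` of `S`. -/
def IsSmoothCurve (h : SurfaceMetric S) (U : Set S) (Γ : ℝ → TangentBundle (𝓡 2) S)
    (I : Set ℝ) : Prop :=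
  ContMDiffOn 𝓘(ℝ, ℝ) (𝓡 2).tangent ∞ Γ I ∧ ∀ t ∈ I, Γ t ∈ unitTangent h ∧ (Γ t).1 ∈ U

/-- `Γ` is, on the open set `I` of times, a null-geodesic of `(V, dg)` over the subset `U` of `S`.
Constant curves are included. -/
def IsNullGeodesic (h : SurfaceMetric S) (U : Set S) (Γ : ℝ → TangentBundle (𝓡 2) S)
    (I : Set ℝ) : Prop :=
  IsSmoothCurve h U Γ I ∧ (∀ t ∈ I, GeodesicEquationAt h Γ t) ∧
    ∀ t ∈ I, dg h (Γ t) (liftVelocity Γ t) (liftVelocity Γ t) = 0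

/-- The null circle `NC(T_p V)`: the set of null lines in the tangent space to `V` at `p`. -/
def nullCircle (h : SurfaceMetric S) (p : TangentBundle (𝓡 2) S) :
    Set (Submodule ℝ (Plane × Plane)) :=
  {ℓ | ∃ ξ ∈ unitTangentSpace h p, ξ ≠ 0 ∧ dg h p ξ ξ = 0 ∧ ℓ = Submodule.span ℝ {ξ}}

/-- The horizontal lift to `p` of a vector `u` tangent to `S` at `p.1`. -/
def horizontalLift (h : SurfaceMetric S) (p : TangentBundle (𝓡 2) S) (u : Plane) :
    Plane × Plane :=
  (u, - vertical h p (u, 0))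

/-- The vertical lift to `p` of a vector `u` tangent to `S` at `p.1`. -/
def verticalLift (_p : TangentBundle (𝓡 2) S) (u : Plane) : Plane × Plane := (0, u)

section Fields

variable {h : SurfaceMetric S} {U : Set S} (o : OrientationOn h U)

/-- The field `X` on `V`: the horizontal lift of `v` at `(σ, v)`. -/
def fieldX (p : TangentBundle (𝓡 2) S) : Plane × Plane := horizontalLift h p p.2

/-- The field `Y` on `V`: the horizontal lift of `J v` at `(σ, v)`. -/
def fieldY (p : TangentBundle (𝓡 2) S) : Plane × Plane := horizontalLift h p (o.J p.1 p.2)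

/-- The field `Z` on `V`: the positive unit tangent field along the fibres. -/
def fieldZ (p : TangentBundle (𝓡 2) S) : Plane × Plane := verticalLift p (o.J p.1 p.2)

/-- `X(θ) = cos θ X + sin θ Y`, for `z = exp (iθ)` in the unit circle. -/
def rotatedX (p : TangentBundle (𝓡 2) S) (z : Circle) : Plane × Plane :=
  (z : ℂ).re • fieldX (h := h) p + (z : ℂ).im • fieldY o p

/-- The null line spanned by `X(θ) + Z`, where `z = exp (iθ)`. -/
def nullLine (p : TangentBundle (𝓡 2) S) (z : Circle) : Submodule ℝ (Plane × Plane) :=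
  Submodule.span ℝ {rotatedX o p z + fieldZ o p}

/-! Vectors tangent to `V × S¹` at `(p, z)` are pairs of a vector tangent to `V` at `p` and of a
vector in `ℂ` tangent to the unit circle at `z`. -/

/-- The field `X̃` on `V × S¹`. -/
def fieldXt (p : TangentBundle (𝓡 2) S) (z : Circle) : (Plane × Plane) × ℂ := (rotatedX o p z, 0)

/-- The field `Z̃` on `V × S¹`. -/
def fieldZt (p : TangentBundle (𝓡 2) S) (_z : Circle) : (Plane × Plane) × ℂ := (fieldZ o p, 0)

/-- The field `Θ = ∂/∂θ` on `V × S¹`. -/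
def fieldTheta (_p : TangentBundle (𝓡 2) S) (z : Circle) : (Plane × Plane) × ℂ :=
  (0, Complex.I * (z : ℂ))

/-- The field `W = X̃ + Z̃ - (1 + κ) Θ` on `V × S¹`. -/
def fieldW (p : TangentBundle (𝓡 2) S) (z : Circle) : (Plane × Plane) × ℂ :=
  fieldXt o p z + fieldZt o p z - (1 + gaussCurvature h p.1) • fieldTheta p z

/-- On the open set `I` of times, `(Γ, z)` is an integral curve of the multiple `r W` of `W`. -/
def IsIntegralCurveW (r : ℝ) (Γ : ℝ → TangentBundle (𝓡 2) S) (z : ℝ → Circle) (I : Set ℝ) : Prop :=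
  IsSmoothCurve h U Γ I ∧ ∀ t ∈ I,
    liftVelocity Γ t = (r • fieldW o (Γ t) (z t)).1 ∧
    HasDerivAt (fun s => (z s : ℂ)) (r • fieldW o (Γ t) (z t)).2 t

end Fields

end Surface

end MagneticExtension

end

open MagneticExtension

noncomputable section

namespace MagneticExtension

/-! ### Metrics on open sets of a coordinate space -/

section MetricOn

set_option synthInstance.maxHeartbeats 200000

variable {F : Type*} [NormedAddCommGroup F] [NormedSpace ℝ F]

/-! Over a chart, Gram-Schmidt gives an orthonormal frame with connection form ω, and a point of V
is a base point y together with the angle α of a unit vector v. The vertical part of a vector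
tangent to V is (dα + ω) Jv, so the magnetic metric is the Kaluza-Klein metric G - (dα + ω)²
(`magneticMetric_apply`), whose coefficients do not involve α. Its Euler-Lagrange equations
therefore say that the angular velocity p = α' + ω(c') is conserved and that the base curve c feels
the force p dω(c', ·). Since dω is -κ times the area form (`connectionForm_differential`), the
second equation reads ∇c' = -κ p Jc' (`acceleration_magneticMetric_eq_zero_iff`).

Nullity means that c' has length |p|; this gives the constant speed and, on dividing by the cube of
the speed, the geodesic curvature -κ sign p. Relative to parallel transport, v turns at rate p and
c' at rate -κ p, so c' turns at rate -(1 + κ) p in the moving frame (v, Jv). That last statement is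
equivalent to the equation of motion (`IsAngleAt.acceleration_eq_iff`), and it is the Θ-component of
rW; hence both the natural lift statement and its converse.

Pointwise, a tangent null vector has horizontal and vertical parts of equal length. A nonzero one
can be rescaled in exactly one way to have vertical part Jv, and its horizontal part is then a unit
vector, that is, an angle θ (`bijOn_nullLine`).

Two points are needed to globalise. Velocities are expressed in the chart at the moving point, while
the equations live in the chart at a fixed time; `vertical_liftVelocity` passes between them through
the transformation law of the Christoffel symbols. The rotation J of the orientation agrees with
that of the chart up to a sign ε = ±1, locally constant along curves
(`eventually_orientationSign_eq`), so r = ε p is a chart-free quantity, and it is constant on a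
connected interval. The speed involves only p², so its constancy needs no orientation. -/

instance instNormedAddCommGroupDual : NormedAddCommGroup (F →L[ℝ] ℝ) :=
  ContinuousLinearMap.toNormedAddCommGroup

instance instNormedSpaceDual : NormedSpace ℝ (F →L[ℝ] ℝ) :=
  ContinuousLinearMap.toNormedSpace

instance instNormedAddCommGroupBilin : NormedAddCommGroup (F →L[ℝ] F →L[ℝ] ℝ) :=
  ContinuousLinearMap.toNormedAddCommGroup

instance instNormedSpaceBilin : NormedSpace ℝ (F →L[ℝ] F →L[ℝ] ℝ) :=
  ContinuousLinearMap.toNormedSpace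

instance instNormedAddCommGroupTrilin : NormedAddCommGroup (F →L[ℝ] F →L[ℝ] F →L[ℝ] ℝ) :=
  ContinuousLinearMap.toNormedAddCommGroup

instance instNormedSpaceTrilin : NormedSpace ℝ (F →L[ℝ] F →L[ℝ] F →L[ℝ] ℝ) :=
  ContinuousLinearMap.toNormedSpace

theorem two_le_infty : (2 : WithTop ℕ∞) ≤ ∞ := ENat.LEInfty.out

theorem contDiff_flip {E : Type*} [NormedAddCommGroup E] [NormedSpace ℝ E] {n : WithTop ℕ∞} :
    ContDiff ℝ n (fun B : F →L[ℝ] F →L[ℝ] E => B.flip) := by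
  exact ContinuousLinearEquiv.contDiff (𝕜 := ℝ) (E := F →L[ℝ] F →L[ℝ] E)
    (F := F →L[ℝ] F →L[ℝ] E) (ContinuousLinearMap.flipₗᵢ ℝ F F E).toContinuousLinearEquiv

/-- `G` is a smooth pseudo-Riemannian metric on the open set `Ω`. -/
structure IsMetricOn (G : F → F →L[ℝ] F →L[ℝ] ℝ) (Ω : Set F) : Prop where
  isOpen : IsOpen Ω
  contDiffOn : ContDiffOn ℝ ∞ G Ω
  symm : ∀ x ∈ Ω, ∀ v w, G x v w = G x w v
  nondegenerate : ∀ x ∈ Ω, ∀ v, (∀ w, G x v w = 0) → v = 0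

/-- Nondegeneracy is injectivity of the map into the dual, a space of the same finite dimension.
This makes `christoffel_spec` available. -/
theorem isInvertible_of_nondegenerate [FiniteDimensional ℝ F] (B : F →L[ℝ] F →L[ℝ] ℝ)
    (hB : ∀ v, (∀ w, B v w = 0) → v = 0) : B.IsInvertible := by
  have hinj : Function.Injective (B : F →ₗ[ℝ] F →L[ℝ] ℝ) := by
    rw [← LinearMap.ker_eq_bot, LinearMap.ker_eq_bot']
    intro v hv
    exact hB v fun w => by
      have := congrArg (fun f : F →L[ℝ] ℝ => f w) hv
      simpa using this
  have hfin : Module.finrank ℝ F = Module.finrank ℝ (F →L[ℝ] ℝ) := by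
    rw [← (LinearMap.toContinuousLinearMap (𝕜 := ℝ) (E := F) (F' := ℝ)).finrank_eq]
    exact (Subspace.dual_finrank_eq (K := ℝ) (V := F)).symm
  refine ⟨(LinearEquiv.ofInjectiveOfFinrankEq _ hinj hfin).toContinuousLinearEquiv, ?_⟩
  ext v w
  rfl

/-- The Christoffel symbols as a bilinear map. -/
def christoffelBilin (G : F → F →L[ℝ] F →L[ℝ] ℝ) (x : F) : F →L[ℝ] F →L[ℝ] F :=
  (ContinuousLinearMap.compL ℝ F (F →L[ℝ] ℝ) F (G x).inverse).comp
    ((1 / 2 : ℝ) • (fderiv ℝ G x + (fderiv ℝ G x).flip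
      - ((ContinuousLinearMap.flipₗᵢ ℝ F F ℝ).toContinuousLinearEquiv :
          (F →L[ℝ] F →L[ℝ] ℝ) →L[ℝ] (F →L[ℝ] F →L[ℝ] ℝ)).comp (fderiv ℝ G x).flip))

theorem christoffelBilin_apply (G : F → F →L[ℝ] F →L[ℝ] ℝ) (x u v : F) :
    christoffelBilin G x u v = christoffel G x u v := by
  rfl

namespace IsMetricOn

variable {G : F → F →L[ℝ] F →L[ℝ] ℝ} {Ω : Set F} (hG : IsMetricOn G Ω) {x : F}
include hG

theorem mem_nhds (hx : x ∈ Ω) : Ω ∈ 𝓝 x := hG.isOpen.mem_nhds hx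

theorem contDiffAt (hx : x ∈ Ω) : ContDiffAt ℝ ∞ G x := hG.contDiffOn.contDiffAt (hG.mem_nhds hx)

theorem differentiableAt (hx : x ∈ Ω) : DifferentiableAt ℝ G x :=
  (hG.contDiffAt hx).differentiableAt (by simp)

/-- The symmetry of the metric holds on the open set Ω, hence near x, and can be differentiated. -/
theorem fderiv_symm (hx : x ∈ Ω) (a v w : F) : fderiv ℝ G x a v w = fderiv ℝ G x a w v := by
  have h1 : ∀ v w, HasFDerivAt (fun y => G y v w)
      (((ContinuousLinearMap.apply ℝ ℝ w).comp (ContinuousLinearMap.apply ℝ (F →L[ℝ] ℝ) v)).comp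
        (fderiv ℝ G x)) x := fun v w =>
    ((ContinuousLinearMap.apply ℝ ℝ w).comp
      (ContinuousLinearMap.apply ℝ (F →L[ℝ] ℝ) v)).hasFDerivAt.comp x
      (hG.differentiableAt hx).hasFDerivAt
  have h2 : (fun y => G y v w) =ᶠ[𝓝 x] fun y => G y w v := by
    filter_upwards [hG.mem_nhds hx] with y hy using hG.symm y hy v w
  have h3 := (h1 v w).unique ((h1 w v).congr_of_eventuallyEq h2)
  simpa using congrArg (fun f : F →L[ℝ] ℝ => f a) h3

theorem ext_iff (hx : x ∈ Ω) {v w : F} : v = w ↔ ∀ b, G x v b = G x w b := by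
  refine ⟨fun h b => by rw [h], fun h => ?_⟩
  rw [← sub_eq_zero]
  exact hG.nondegenerate x hx _ fun b => by simp [h b]

variable [FiniteDimensional ℝ F]

theorem isInvertible (hx : x ∈ Ω) : (G x).IsInvertible :=
  isInvertible_of_nondegenerate _ (hG.nondegenerate x hx)

/-- The Levi-Civita connection is torsion-free. -/
theorem christoffel_symm (hx : x ∈ Ω) (u v : F) : christoffel G x u v = christoffel G x v u := by
  rw [hG.ext_iff hx]
  intro b
  rw [christoffel_spec _ _ _ _ _ (hG.isInvertible hx),
    christoffel_spec _ _ _ _ _ (hG.isInvertible hx), hG.fderiv_symm hx b u v]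
  ring

/-- Compatibility of the connection with the metric: in the sum of the two symbols of the first
kind, only the derivative in the direction `a` survives. -/
theorem fderiv_eq (hx : x ∈ Ω) (a u v : F) :
    fderiv ℝ G x a u v = G x (christoffel G x a u) v + G x u (christoffel G x a v) := by
  rw [hG.symm x hx u, christoffel_spec _ _ _ _ _ (hG.isInvertible hx),
    christoffel_spec _ _ _ _ _ (hG.isInvertible hx), hG.fderiv_symm hx a v u,
    hG.fderiv_symm hx u a v, hG.fderiv_symm hx v a u]
  ring

theorem contDiffAt_christoffelBilin (hx : x ∈ Ω) : ContDiffAt ℝ ∞ (christoffelBilin G) x := by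
  obtain ⟨A, hA⟩ := hG.isInvertible hx
  have h1 : ContDiffAt ℝ ∞ (fun y => (G y).inverse) x := by
    have : ContDiffAt ℝ ∞ ContinuousLinearMap.inverse (G x) := by
      rw [← hA]
      exact contDiffAt_map_inverse A
    exact this.comp x (hG.contDiffAt hx)
  have h2 : ContDiffAt ℝ ∞ (fderiv ℝ G) x := (hG.contDiffAt hx).fderiv_right (by simp)
  have h3 : ContDiffAt ℝ ∞ (fun y => (fderiv ℝ G y).flip) x :=
    (ContinuousLinearMap.flipₗᵢ ℝ F F (F →L[ℝ] ℝ)).toContinuousLinearEquiv.contDiff.contDiffAt.comp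
      x h2
  unfold christoffelBilin
  refine ContDiffAt.clm_comp ?_ ?_
  · exact (ContinuousLinearMap.compL ℝ F (F →L[ℝ] ℝ) F).contDiff.contDiffAt.comp x h1
  · exact ((h2.add h3).sub (contDiffAt_const.clm_comp h3)).const_smul _

/-- The acceleration of a curve vanishes if and only if the curve satisfies the Euler-Lagrange
equations of the energy. -/
theorem acceleration_eq_iff (c : ℝ → F) (t : ℝ) (hx : c t ∈ Ω) (a : F) :
    acceleration G c t = a ↔ ∀ b, G (c t) (deriv (deriv c) t) b
      + fderiv ℝ G (c t) (deriv c t) (deriv c t) b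
      - 1 / 2 * fderiv ℝ G (c t) b (deriv c t) (deriv c t) = G (c t) a b := by
  rw [hG.ext_iff hx]
  refine forall_congr' fun b => ?_
  rw [acceleration, map_add, add_apply, christoffel_spec _ _ _ _ _ (hG.isInvertible hx)]
  constructor <;> intro h <;> rw [← h] <;> ring

end IsMetricOn

/-- The covariant derivative at time `s` of a vector field `A` along the curve `c`. -/
def covDeriv (G : F → F →L[ℝ] F →L[ℝ] ℝ) (c A : ℝ → F) (s : ℝ) : F :=
  deriv A s + christoffel G (c s) (A s) (deriv c s)

/-- The covariant derivative at `x`, in the direction `a`, of the vector field `f`. -/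
def covFDeriv (G : F → F →L[ℝ] F →L[ℝ] ℝ) (f : F → F) (x a : F) : F :=
  fderiv ℝ f x a + christoffel G x a (f x)

theorem acceleration_eq_covDeriv (G : F → F →L[ℝ] F →L[ℝ] ℝ) (c : ℝ → F) (t : ℝ) :
    acceleration G c t = covDeriv G c (deriv c) t := rfl

namespace IsMetricOn

variable [FiniteDimensional ℝ F]
variable {G : F → F →L[ℝ] F →L[ℝ] ℝ} {Ω : Set F} (hG : IsMetricOn G Ω) {x : F}
include hG

theorem hasDerivAt_inner {c A B : ℝ → F} {s : ℝ} (hs : c s ∈ Ω) (hc : DifferentiableAt ℝ c s)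
    (hA : DifferentiableAt ℝ A s) (hB : DifferentiableAt ℝ B s) :
    HasDerivAt (fun σ => G (c σ) (A σ) (B σ))
      (G (c s) (covDeriv G c A s) (B s) + G (c s) (A s) (covDeriv G c B s)) s := by
  have h1 : HasDerivAt (fun σ => G (c σ)) (fderiv ℝ G (c s) (deriv c s)) s :=
    (hG.differentiableAt hs).hasFDerivAt.comp_hasDerivAt s hc.hasDerivAt
  have h2 := (h1.clm_apply hA.hasDerivAt).clm_apply hB.hasDerivAt
  refine h2.congr_deriv ?_
  simp only [covDeriv, map_add, add_apply, hG.fderiv_eq hs,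
    hG.christoffel_symm hs (deriv c s)]
  ring

theorem hasFDerivAt_inner {f g : F → F} (hx : x ∈ Ω) (hf : DifferentiableAt ℝ f x)
    (hg : DifferentiableAt ℝ g x) (a : F) :
    fderiv ℝ (fun y => G y (f y) (g y)) x a
      = G x (covFDeriv G f x a) (g x) + G x (f x) (covFDeriv G g x a) := by
  have h2 := ((hG.differentiableAt hx).hasFDerivAt.clm_apply hf.hasFDerivAt).clm_apply hg.hasFDerivAt
  rw [h2.fderiv]
  simp [covFDeriv, hG.fderiv_eq hx]
  ring

end IsMetricOn

/-- The transformation law of the Christoffel symbols under a change of coordinates `φ`. -/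
theorem christoffel_pullback [FiniteDimensional ℝ F] {G H : F → F →L[ℝ] F →L[ℝ] ℝ} {Ω Ω' : Set F}
    (hG : IsMetricOn G Ω) (hH : IsMetricOn H Ω') {φ : F → F} {x : F} (hx : x ∈ Ω) (hx' : φ x ∈ Ω')
    (hφ : ContDiffAt ℝ 2 φ x) (hbij : Function.Surjective (fderiv ℝ φ x))
    (hpull : ∀ᶠ y in 𝓝 x, ∀ v w, G y v w = H (φ y) (fderiv ℝ φ y v) (fderiv ℝ φ y w)) (u v : F) :
    fderiv ℝ φ x (christoffel G x u v)
      = fderiv ℝ (fderiv ℝ φ) x u v + christoffel H (φ x) (fderiv ℝ φ x u) (fderiv ℝ φ x v) := by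
  have hd : DifferentiableAt ℝ φ x := hφ.differentiableAt (by simp)
  have hdd : DifferentiableAt ℝ (fderiv ℝ φ) x :=
    (hφ.fderiv_right (m := 1) (by norm_num)).differentiableAt (by simp)
  have hsymm : ∀ u v, fderiv ℝ (fderiv ℝ φ) x u v = fderiv ℝ (fderiv ℝ φ) x v u := fun u v =>
    (hφ.isSymmSndFDerivAt (by simp)) u v
  -- The pullback identity is differentiated; the second derivatives of φ that appear here produce
  -- the inhomogeneous term.
  have key : ∀ a v w, fderiv ℝ G x a v w
      = fderiv ℝ H (φ x) (fderiv ℝ φ x a) (fderiv ℝ φ x v) (fderiv ℝ φ x w)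
        + H (φ x) (fderiv ℝ (fderiv ℝ φ) x a v) (fderiv ℝ φ x w)
        + H (φ x) (fderiv ℝ φ x v) (fderiv ℝ (fderiv ℝ φ) x a w) := by
    intro a v w
    have h1 := ((hG.differentiableAt hx).hasFDerivAt.clm_apply
      (hasFDerivAt_const v x)).clm_apply (hasFDerivAt_const w x)
    have h2 := (((hH.differentiableAt hx').hasFDerivAt.comp x hd.hasFDerivAt).clm_apply
      (hdd.hasFDerivAt.clm_apply (hasFDerivAt_const v x))).clm_apply
      (hdd.hasFDerivAt.clm_apply (hasFDerivAt_const w x))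
    have h3 := h1.unique (h2.congr_of_eventuallyEq (hpull.mono fun y hy => hy v w))
    have h4 := congrArg (fun f : F →L[ℝ] ℝ => f a) h3
    simp at h4
    linarith
  rw [hH.ext_iff hx']
  intro b
  -- Surjectivity of the differential makes it enough to test against pushed-forward vectors.
  obtain ⟨w, rfl⟩ := hbij b
  rw [← hpull.self_of_nhds, christoffel_spec _ _ _ _ _ (hG.isInvertible hx), map_add, add_apply,
    christoffel_spec _ _ _ _ _ (hH.isInvertible hx'), key, key, key, hsymm v u, hsymm w u,
    hsymm w v, hH.symm _ hx' (fderiv ℝ φ x u), hH.symm _ hx' (fderiv ℝ φ x v) ]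
  ring

end MetricOn

/-! ### Riemannian metrics on open sets of the plane -/

section PlaneMetric

set_option synthInstance.maxHeartbeats 200000

theorem plane_eq (v : Plane) : v = v 0 • (!₂[1, 0] : Plane) + v 1 • (!₂[0, 1] : Plane) := by
  ext i
  fin_cases i <;> simp

/-- `G` is a smooth Riemannian metric on the open set `Ω` of the coordinate plane. -/
structure IsRiemannianOn (G : Plane → Plane →L[ℝ] Plane →L[ℝ] ℝ) (Ω : Set Plane) : Prop where
  isOpen : IsOpen Ω
  contDiffOn : ContDiffOn ℝ ∞ G Ω
  symm : ∀ x ∈ Ω, ∀ v w, G x v w = G x w v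
  pos : ∀ x ∈ Ω, ∀ v, v ≠ 0 → 0 < G x v v

/-- The connection form `a ↦ ⟨∇_a e₁, e₂⟩` of the orthonormal frame. -/
def connectionForm (G : Plane → Plane →L[ℝ] Plane →L[ℝ] ℝ) (y : Plane) : Plane →L[ℝ] ℝ :=
  (G y (frameTwo G y)).comp
    (fderiv ℝ (frameOne G) y + (christoffelBilin G y).flip (frameOne G y))

/-- The rotation by a right angle that sends `frameOne` to `frameTwo`. -/
def frameRotation (G : Plane → Plane →L[ℝ] Plane →L[ℝ] ℝ) (y : Plane) : Plane →L[ℝ] Plane :=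
  ((G y).flip (frameOne G y)).smulRight (frameTwo G y)
    - ((G y).flip (frameTwo G y)).smulRight (frameOne G y)

/-- The Gaussian curvature in coordinates. -/
def coordCurvature (G : Plane → Plane →L[ℝ] Plane →L[ℝ] ℝ) (y : Plane) : ℝ :=
  let e₁ : Plane := !₂[1, 0]
  let e₂ : Plane := !₂[0, 1]
  G y (riemann G y e₁ e₂ e₂) e₁ / (G y e₁ e₁ * G y e₂ e₂ - G y e₁ e₂ ^ 2)

theorem frameRotation_apply (G : Plane → Plane →L[ℝ] Plane →L[ℝ] ℝ) (y w : Plane) :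
    frameRotation G y w
      = G y w (frameOne G y) • frameTwo G y - G y w (frameTwo G y) • frameOne G y := by
  simp [frameRotation]

namespace IsRiemannianOn

/-! ### The orthonormal frame and the rotation by a right angle -/

theorem e_one_ne_zero : (!₂[1, 0] : Plane) ≠ 0 := fun h => by
  simpa using congrArg (fun v : Plane => v 0) h

/-- The first frame vector is a multiple of the first coordinate vector, whatever `G` is, so the
second coordinate of the difference is 1. -/
theorem gramSchmidt_ne_zero {G : Plane → Plane →L[ℝ] Plane →L[ℝ] ℝ} {y : Plane} :
    (!₂[0, 1] : Plane) - G y !₂[0, 1] (frameOne G y) • frameOne G y ≠ 0 := fun h => by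
  simpa [frameOne] using congrArg (fun v : Plane => v 1) h

variable {G : Plane → Plane →L[ℝ] Plane →L[ℝ] ℝ} {Ω : Set Plane} (hG : IsRiemannianOn G Ω)
  {y : Plane}
include hG

theorem isMetricOn : IsMetricOn G Ω where
  isOpen := hG.isOpen
  contDiffOn := hG.contDiffOn
  symm := hG.symm
  nondegenerate x hx v hv := by
    by_contra h
    exact (hG.pos x hx v h).ne' (hv v)

theorem eq_zero_of_self (hy : y ∈ Ω) {v : Plane} (hv : G y v v = 0) : v = 0 := by
  by_contra h
  exact (hG.pos y hy v h).ne' hv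

theorem unit_normalize (hy : y ∈ Ω) {n : Plane} (hn : n ≠ 0) :
    G y ((√(G y n n))⁻¹ • n) ((√(G y n n))⁻¹ • n) = 1 := by
  have h := hG.pos y hy n hn
  have h2 : √(G y n n) ≠ 0 := (Real.sqrt_pos.2 h).ne'
  have h3 : √(G y n n) * √(G y n n) = G y n n := Real.mul_self_sqrt h.le
  simp only [map_smul, smul_apply, smul_eq_mul]
  field_simp
  linarith

theorem frameOne_self (hy : y ∈ Ω) : G y (frameOne G y) (frameOne G y) = 1 :=
  hG.unit_normalize hy e_one_ne_zero

theorem frameTwo_self (hy : y ∈ Ω) : G y (frameTwo G y) (frameTwo G y) = 1 :=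
  hG.unit_normalize hy gramSchmidt_ne_zero

theorem frameOne_frameTwo (hy : y ∈ Ω) : G y (frameOne G y) (frameTwo G y) = 0 := by
  have h := hG.frameOne_self hy
  simp [frameTwo, h, hG.symm y hy (frameOne G y) !₂[0, 1]]

theorem frameTwo_frameOne (hy : y ∈ Ω) : G y (frameTwo G y) (frameOne G y) = 0 := by
  rw [hG.symm y hy, hG.frameOne_frameTwo hy]

/-- Gram-Schmidt is triangular, so the frame spans the plane; orthonormality then identifies the
coefficients. -/
theorem frame_expand (hy : y ∈ Ω) (w : Plane) :
    w = G y w (frameOne G y) • frameOne G y + G y w (frameTwo G y) • frameTwo G y := by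
  have h1 : ∃ a : ℝ, (!₂[1, 0] : Plane) = a • frameOne G y := by
    have h := Real.sqrt_pos.2 (hG.pos y hy _ e_one_ne_zero)
    exact ⟨√(G y !₂[1, 0] !₂[1, 0]), by simp only [frameOne]; rw [smul_inv_smul₀ h.ne']⟩
  have h2 : ∃ a b : ℝ, (!₂[0, 1] : Plane) = a • frameOne G y + b • frameTwo G y := by
    have h := Real.sqrt_pos.2 (hG.pos y hy _ (gramSchmidt_ne_zero (G := G) (y := y)))
    exact ⟨_, _, by simp only [frameTwo]; rw [smul_inv_smul₀ h.ne', add_sub_cancel]⟩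
  obtain ⟨a, ha⟩ := h1
  obtain ⟨b, c, hbc⟩ := h2
  have h3 : ∃ p q : ℝ, w = p • frameOne G y + q • frameTwo G y := by
    refine ⟨w 0 * a + w 1 * b, w 1 * c, ?_⟩
    conv_lhs => rw [plane_eq w, ha, hbc]
    module
  obtain ⟨p, q, hpq⟩ := h3
  conv_rhs => rw [hpq]
  simp only [map_add, map_smul, add_apply, smul_apply, hG.frameOne_self hy,
    hG.frameTwo_self hy, hG.frameOne_frameTwo hy, hG.frameTwo_frameOne hy]
  rw [hpq]
  simp

theorem inner_frame (hy : y ∈ Ω) (v w : Plane) :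
    G y v w = G y v (frameOne G y) * G y w (frameOne G y)
      + G y v (frameTwo G y) * G y w (frameTwo G y) := by
  conv_lhs => rw [hG.frame_expand hy w]
  simp
  ring

theorem rotation_frameOne (hy : y ∈ Ω) : frameRotation G y (frameOne G y) = frameTwo G y := by
  simp [frameRotation_apply, hG.frameOne_self hy, hG.frameOne_frameTwo hy]

theorem rotation_frameTwo (hy : y ∈ Ω) : frameRotation G y (frameTwo G y) = -frameOne G y := by
  simp [frameRotation_apply, hG.frameTwo_self hy, hG.frameTwo_frameOne hy]

theorem rotation_rotation (hy : y ∈ Ω) (w : Plane) :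
    frameRotation G y (frameRotation G y w) = -w := by
  conv_rhs => rw [hG.frame_expand hy w]
  rw [frameRotation_apply G y w, map_sub, map_smul, map_smul, hG.rotation_frameOne hy,
    hG.rotation_frameTwo hy]
  module

theorem inner_rotation_left (hy : y ∈ Ω) (v w : Plane) :
    G y (frameRotation G y v) w = -G y v (frameRotation G y w) := by
  rw [frameRotation_apply, frameRotation_apply]
  simp only [map_sub, map_smul, sub_apply, smul_apply, smul_eq_mul]
  rw [hG.symm y hy (frameOne G y), hG.symm y hy (frameTwo G y)]
  ring

theorem inner_rotation_rotation (hy : y ∈ Ω) (v w : Plane) :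
    G y (frameRotation G y v) (frameRotation G y w) = G y v w := by
  rw [hG.inner_rotation_left hy, hG.rotation_rotation hy]
  simp

theorem inner_rotation_self (hy : y ∈ Ω) (v : Plane) : G y (frameRotation G y v) v = 0 := by
  have h := hG.inner_rotation_left hy v v
  rw [hG.symm y hy v] at h
  linarith

/-- Expansion of a vector in the orthonormal frame `(v, Jv)` given by a unit vector `v`. -/
theorem rotation_expand (hy : y ∈ Ω) {v : Plane} (hv : G y v v = 1) (w : Plane) :
    w = G y w v • v + G y w (frameRotation G y v) • frameRotation G y v := by
  have h1 := hG.inner_frame hy v v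
  rw [hv] at h1
  rw [hG.inner_frame hy w v, hG.inner_frame hy w (frameRotation G y v),
    frameRotation_apply G y v]
  simp only [map_sub, map_smul, sub_apply, smul_apply, smul_eq_mul, hG.frameOne_self hy,
    hG.frameTwo_self hy, hG.frameOne_frameTwo hy, hG.frameTwo_frameOne hy]
  conv_lhs => rw [hG.frame_expand hy w]
  conv_rhs => rw [hG.frame_expand hy v]
  simp only [map_add, map_smul, add_apply, smul_apply, smul_eq_mul, hG.frameOne_self hy,
    hG.frameTwo_self hy, hG.frameOne_frameTwo hy, hG.frameTwo_frameOne hy]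
  generalize G y v (frameOne G y) = a at *
  generalize G y v (frameTwo G y) = b at *
  generalize G y w (frameOne G y) = c
  generalize G y w (frameTwo G y) = d
  -- The pair (a, b) holds the frame components of v, with a² + b² = 1; the two identities invert
  -- the rotation matrix with entries a, b.
  have e1 : c = (c * a + d * b) * a - (d * a - c * b) * b := by linear_combination c * h1
  have e2 : d = (c * a + d * b) * b + (d * a - c * b) * a := by linear_combination d * h1
  conv_lhs => rw [e1, e2]
  module

/-! #### Smoothness of the frame and of the connection form -/

theorem contDiffAt_normalize (hy : y ∈ Ω) {n : Plane → Plane} (hn : ContDiffAt ℝ ∞ n y)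
    (h0 : n y ≠ 0) : ContDiffAt ℝ ∞ (fun x => (√(G x (n x) (n x)))⁻¹ • n x) y := by
  have h1 : ContDiffAt ℝ ∞ (fun x => G x (n x) (n x)) y :=
    ((hG.isMetricOn.contDiffAt hy).clm_apply hn).clm_apply hn
  have hp := hG.pos y hy _ h0
  exact ((h1.sqrt hp.ne').inv (Real.sqrt_pos.2 hp).ne').smul hn

theorem contDiffAt_frameOne (hy : y ∈ Ω) : ContDiffAt ℝ ∞ (frameOne G) y :=
  hG.contDiffAt_normalize hy (n := fun _ => !₂[1, 0]) contDiffAt_const e_one_ne_zero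

theorem contDiffAt_frameTwo (hy : y ∈ Ω) : ContDiffAt ℝ ∞ (frameTwo G) y := by
  refine hG.contDiffAt_normalize hy
    (n := fun x => !₂[0, 1] - G x !₂[0, 1] (frameOne G x) • frameOne G x) ?_ gramSchmidt_ne_zero
  have h := hG.contDiffAt_frameOne hy
  exact contDiffAt_const.sub ((((hG.isMetricOn.contDiffAt hy).clm_apply contDiffAt_const).clm_apply
    h).smul h)

theorem contDiffAt_connectionForm (hy : y ∈ Ω) : ContDiffAt ℝ ∞ (connectionForm G) y := by
  have h1 : ContDiffAt ℝ ∞ (fderiv ℝ (frameOne G)) y :=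
    (hG.contDiffAt_frameOne hy).fderiv_right (by simp)
  have hflip : ContDiff ℝ ∞ (fun B : Plane →L[ℝ] Plane →L[ℝ] Plane => B.flip) :=
    contDiff_flip
  have h2 : ContDiffAt ℝ ∞ (fun x => (christoffelBilin G x).flip) y :=
    hflip.contDiffAt.comp y (hG.isMetricOn.contDiffAt_christoffelBilin hy)
  exact ((hG.isMetricOn.contDiffAt hy).clm_apply (hG.contDiffAt_frameTwo hy)).clm_comp
    (h1.add (h2.clm_apply (hG.contDiffAt_frameOne hy)))

theorem differentiableAt_frameOne (hy : y ∈ Ω) : DifferentiableAt ℝ (frameOne G) y :=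
  (hG.contDiffAt_frameOne hy).differentiableAt (by simp)

theorem differentiableAt_frameTwo (hy : y ∈ Ω) : DifferentiableAt ℝ (frameTwo G) y :=
  (hG.contDiffAt_frameTwo hy).differentiableAt (by simp)

theorem differentiableAt_connectionForm (hy : y ∈ Ω) :
    DifferentiableAt ℝ (connectionForm G) y :=
  (hG.contDiffAt_connectionForm hy).differentiableAt (by simp)

/-! #### The structure equations -/

theorem inner_covFDeriv_add {f g : Plane → Plane} (hy : y ∈ Ω) (hf : DifferentiableAt ℝ f y)
    (hg : DifferentiableAt ℝ g y) {c : ℝ} (hc : ∀ x ∈ Ω, G x (f x) (g x) = c) (a : Plane) :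
    G y (covFDeriv G f y a) (g y) + G y (f y) (covFDeriv G g y a) = 0 := by
  rw [← hG.isMetricOn.hasFDerivAt_inner hy hf hg]
  have : (fun x => G x (f x) (g x)) =ᶠ[𝓝 y] fun _ => c := by
    filter_upwards [hG.isMetricOn.mem_nhds hy] with x hx using hc x hx
  rw [this.fderiv_eq]
  simp

/-- A field of constant length has covariant derivative orthogonal to itself, so only the other
frame component remains. -/
theorem covFDeriv_frameOne (hy : y ∈ Ω) (a : Plane) :
    covFDeriv G (frameOne G) y a = connectionForm G y a • frameTwo G y := by
  have h1 := hG.inner_covFDeriv_add hy (hG.differentiableAt_frameOne hy)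
    (hG.differentiableAt_frameOne hy) (fun x hx => hG.frameOne_self hx) a
  rw [hG.symm y hy (frameOne G y)] at h1
  have h2 : connectionForm G y a = G y (covFDeriv G (frameOne G) y a) (frameTwo G y) := by
    rw [hG.symm y hy]
    rfl
  rw [hG.frame_expand hy (covFDeriv G (frameOne G) y a), ← h2,
    show G y (covFDeriv G (frameOne G) y a) (frameOne G y) = 0 by linarith]
  simp

theorem covFDeriv_frameTwo (hy : y ∈ Ω) (a : Plane) :
    covFDeriv G (frameTwo G) y a = -(connectionForm G y a • frameOne G y) := by
  have h1 := hG.inner_covFDeriv_add hy (hG.differentiableAt_frameTwo hy)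
    (hG.differentiableAt_frameTwo hy) (fun x hx => hG.frameTwo_self hx) a
  rw [hG.symm y hy (frameTwo G y)] at h1
  have h2 := hG.inner_covFDeriv_add hy (hG.differentiableAt_frameTwo hy)
    (hG.differentiableAt_frameOne hy) (fun x hx => hG.frameTwo_frameOne hx) a
  rw [hG.covFDeriv_frameOne hy, map_smul, hG.frameTwo_self hy, smul_eq_mul, mul_one] at h2
  rw [hG.frame_expand hy (covFDeriv G (frameTwo G) y a),
    show G y (covFDeriv G (frameTwo G) y a) (frameTwo G y) = 0 by linarith,
    show G y (covFDeriv G (frameTwo G) y a) (frameOne G y) = -connectionForm G y a by linarith]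
  simp

theorem riemann_eq (hy : y ∈ Ω) (a b w : Plane) :
    riemann G y a b w = fderiv ℝ (christoffelBilin G) y a b w
      - fderiv ℝ (christoffelBilin G) y b a w
      + christoffelBilin G y a (christoffelBilin G y b w)
      - christoffelBilin G y b (christoffelBilin G y a w) := by
  have hK := ((hG.isMetricOn.contDiffAt_christoffelBilin hy).differentiableAt
    (by simp)).hasFDerivAt
  have h : ∀ v, fderiv ℝ (fun x => christoffel G x v w) y
      = ((fderiv ℝ (christoffelBilin G) y).flip v).flip w := fun v => by
    have := (hK.clm_apply (hasFDerivAt_const v y)).clm_apply (hasFDerivAt_const w y)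
    refine HasFDerivAt.fderiv (this.congr_fderiv ?_)
    ext
    simp
  simp only [riemann, h, christoffelBilin_apply, ContinuousLinearMap.flip_apply]

/-- If `∇ f = η g` and `∇ g = - η f`, then `R(a, b) f = dη(a, b) g`. -/
theorem riemann_of_covFDeriv (hy : y ∈ Ω) {f g : Plane → Plane} {η : Plane → Plane →L[ℝ] ℝ}
    (hf : ContDiffAt ℝ ∞ f y) (hg : DifferentiableAt ℝ g y) (hη : DifferentiableAt ℝ η y)
    (hfg : ∀ x ∈ Ω, ∀ a, covFDeriv G f x a = η x a • g x)
    (hgf : ∀ a, covFDeriv G g y a = -(η y a • f y)) (a b : Plane) :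
    riemann G y a b (f y) = (fderiv ℝ η y a b - fderiv ℝ η y b a) • g y := by
  have hK := ((hG.isMetricOn.contDiffAt_christoffelBilin hy).differentiableAt
    (by simp)).hasFDerivAt
  have hf2 : ContDiffAt ℝ 2 f y := hf.of_le two_le_infty
  have hd := (hf2.differentiableAt (by simp)).hasFDerivAt
  have hdd := ((hf2.fderiv_right (m := 1) (by norm_num)).differentiableAt (by simp)).hasFDerivAt
  have hs : fderiv ℝ (fderiv ℝ f) y a b = fderiv ℝ (fderiv ℝ f) y b a :=
    (hf2.isSymmSndFDerivAt (by simp)) a b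
  -- The structure equation ∇_b f = η(b) g, valid near y, is differentiated in the direction a.
  -- After antisymmetrisation in a and b, the second derivatives of f and the products η(a) η(b)
  -- drop out.
  have key : ∀ a b, fderiv ℝ (fderiv ℝ f) y a b + (fderiv ℝ (christoffelBilin G) y a b (f y)
      + christoffelBilin G y b (fderiv ℝ f y a))
      = fderiv ℝ η y a b • g y + η y b • fderiv ℝ g y a := by
    intro a b
    have h1 := (hdd.clm_apply (hasFDerivAt_const b y)).add
      ((hK.clm_apply (hasFDerivAt_const b y)).clm_apply hd)
    have h2 := (hη.hasFDerivAt.clm_apply (hasFDerivAt_const b y)).smul hg.hasFDerivAt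
    have h3 : (fun x => fderiv ℝ f x b + christoffelBilin G x b (f x))
        =ᶠ[𝓝 y] fun x => η x b • g x := by
      filter_upwards [hG.isMetricOn.mem_nhds hy] with x hx using hfg x hx b
    have h4 := congrArg (fun L : Plane →L[ℝ] Plane => L a) (h1.unique (h2.congr_of_eventuallyEq h3))
    simp at h4
    rw [add_comm (christoffelBilin G y b (fderiv ℝ f y a))] at h4
    rw [h4, add_comm]
  have hDf : ∀ a, fderiv ℝ f y a = η y a • g y - christoffelBilin G y a (f y) := fun a =>
    eq_sub_of_add_eq (hfg y hy a)
  have hDg : ∀ a, fderiv ℝ g y a = -(η y a • f y) - christoffelBilin G y a (g y) := fun a =>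
    eq_sub_of_add_eq (hgf a)
  have hk : ∀ a b, fderiv ℝ (christoffelBilin G) y a b (f y)
      = fderiv ℝ η y a b • g y + η y b • (-(η y a • f y) - christoffelBilin G y a (g y))
        - (η y a • christoffelBilin G y b (g y)
          - christoffelBilin G y b (christoffelBilin G y a (f y)))
        - fderiv ℝ (fderiv ℝ f) y a b := by
    intro a b
    rw [← hDg, ← map_smul (christoffelBilin G y b), ← map_sub (christoffelBilin G y b), ← hDf,
      ← key]
    abel
  rw [hG.riemann_eq hy, hk, hk, hs]
  module

theorem riemann_frameOne (hy : y ∈ Ω) (a b : Plane) :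
    riemann G y a b (frameOne G y)
      = (fderiv ℝ (connectionForm G) y a b - fderiv ℝ (connectionForm G) y b a)
        • frameTwo G y :=
  hG.riemann_of_covFDeriv hy (hG.contDiffAt_frameOne hy) (hG.differentiableAt_frameTwo hy)
    (hG.differentiableAt_connectionForm hy) (fun _ hx => hG.covFDeriv_frameOne hx)
    (hG.covFDeriv_frameTwo hy) a b

/-- The pair (e₂, -e₁) of frame vectors satisfies the same structure equations as (e₁, e₂). -/
theorem riemann_frameTwo (hy : y ∈ Ω) (a b : Plane) :
    riemann G y a b (frameTwo G y)
      = -((fderiv ℝ (connectionForm G) y a b - fderiv ℝ (connectionForm G) y b a)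
        • frameOne G y) := by
  rw [hG.riemann_of_covFDeriv hy (hG.contDiffAt_frameTwo hy) (hG.differentiableAt_frameOne hy).neg
    (hG.differentiableAt_connectionForm hy) (fun x hx a => by
      rw [hG.covFDeriv_frameTwo hx]; simp) (fun a => ?_) a b]
  · simp
  · rw [← hG.covFDeriv_frameOne hy]
    simp only [covFDeriv, Pi.neg_apply, map_neg, ← christoffelBilin_apply]
    rw [fderiv_neg, neg_apply]
    abel

/-- The curvature form is minus the differential of the connection form. -/
theorem connectionForm_differential (hy : y ∈ Ω) (a b : Plane) :
    fderiv ℝ (connectionForm G) y a b - fderiv ℝ (connectionForm G) y b a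
      = -(coordCurvature G y * G y (frameRotation G y a) b) := by
  -- Alternating forms on the plane are multiples of the determinant, so both sides need only be
  -- compared on the coordinate vectors.
  have hanti : ∀ B : Plane →L[ℝ] Plane →L[ℝ] ℝ, B a b - B b a
      = (a 0 * b 1 - a 1 * b 0) * (B !₂[1, 0] !₂[0, 1] - B !₂[0, 1] !₂[1, 0]) := fun B => by
    rw [plane_eq a, plane_eq b]
    simp
    ring
  have hrot : ∀ a b, G y (frameRotation G y a) b
      = G y a (frameOne G y) * G y b (frameTwo G y)
        - G y a (frameTwo G y) * G y b (frameOne G y) := fun a b => by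
    rw [frameRotation_apply]
    simp [hG.symm y hy b]
  have hcurv := hG.riemann_frameOne hy !₂[1, 0] !₂[0, 1]
  have hcurv2 := hG.riemann_frameTwo hy !₂[1, 0] !₂[0, 1]
  have hlin : ∀ p q : ℝ, riemann G y !₂[1, 0] !₂[0, 1] (p • frameOne G y + q • frameTwo G y)
      = p • riemann G y !₂[1, 0] !₂[0, 1] (frameOne G y)
        + q • riemann G y !₂[1, 0] !₂[0, 1] (frameTwo G y) := fun p q => by
    simp only [hG.riemann_eq hy, map_add, map_smul]
    module
  have harea : G y (frameRotation G y a) b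
      = (a 0 * b 1 - a 1 * b 0) * G y (frameRotation G y !₂[1, 0]) !₂[0, 1] := by
    have h := hanti (G y ∘L frameRotation G y)
    have h2 : ∀ a b, G y (frameRotation G y b) a = -G y (frameRotation G y a) b := fun a b => by
      rw [hrot, hrot]; ring
    simp only [ContinuousLinearMap.comp_apply, h2 a b, h2 !₂[1, 0] !₂[0, 1]] at h
    linarith
  -- Otherwise the rotated first coordinate vector would be orthogonal to both coordinate vectors,
  -- hence zero, against J² = -1.
  have hne : G y (frameRotation G y !₂[1, 0]) !₂[0, 1] ≠ 0 := by
    intro h0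
    have h2 := hG.rotation_rotation hy !₂[1, 0]
    have h3 : frameRotation G y !₂[1, 0] = 0 := hG.isMetricOn.nondegenerate y hy _ fun w => by
      rw [plane_eq w, map_add, map_smul, map_smul, h0, hG.inner_rotation_self hy]
      simp
    rw [h3, map_zero] at h2
    exact e_one_ne_zero (neg_eq_zero.1 h2.symm)
  rw [harea, hanti]
  have hk : coordCurvature G y * G y (frameRotation G y !₂[1, 0]) !₂[0, 1]
      = -(fderiv ℝ (connectionForm G) y !₂[1, 0] !₂[0, 1]
        - fderiv ℝ (connectionForm G) y !₂[0, 1] !₂[1, 0]) := by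
    -- Lagrange's identity: the Gram determinant is the square of the area.
    have hd : G y !₂[1, 0] !₂[1, 0] * G y !₂[0, 1] !₂[0, 1] - G y !₂[1, 0] !₂[0, 1] ^ 2
        = G y (frameRotation G y !₂[1, 0]) !₂[0, 1] ^ 2 := by
      rw [hrot, hG.inner_frame hy !₂[1, 0] !₂[1, 0], hG.inner_frame hy !₂[0, 1] !₂[0, 1],
        hG.inner_frame hy !₂[1, 0] !₂[0, 1]]
      ring
    have hn : G y (riemann G y !₂[1, 0] !₂[0, 1] !₂[0, 1]) !₂[1, 0]
        = -(fderiv ℝ (connectionForm G) y !₂[1, 0] !₂[0, 1]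
        - fderiv ℝ (connectionForm G) y !₂[0, 1] !₂[1, 0])
          * G y (frameRotation G y !₂[1, 0]) !₂[0, 1] := by
      have h := hlin (G y !₂[0, 1] (frameOne G y)) (G y !₂[0, 1] (frameTwo G y))
      rw [← hG.frame_expand hy, hcurv, hcurv2] at h
      rw [h, hrot]
      simp only [map_add, map_smul, map_neg, add_apply, smul_apply, neg_apply, smul_eq_mul,
        hG.symm y hy (frameOne G y) !₂[1, 0], hG.symm y hy (frameTwo G y) !₂[1, 0]]
      ring
    rw [coordCurvature]
    simp only [hd, hn]
    field_simp
  linear_combination (a 0 * b 1 - a 1 * b 0) * hk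

end IsRiemannianOn

end PlaneMetric

/-! ### The magnetic metric in coordinates -/

section MagneticCoordinates

set_option synthInstance.maxHeartbeats 200000

/-- The form `dα + ω` on the coordinate space of the unit tangent bundle. -/
def angularForm (G : Plane → Plane →L[ℝ] Plane →L[ℝ] ℝ) (q : Plane × ℝ) : Plane × ℝ →L[ℝ] ℝ :=
  ContinuousLinearMap.snd ℝ Plane ℝ
    + (connectionForm G q.1).comp (ContinuousLinearMap.fst ℝ Plane ℝ)

theorem angularForm_apply (G : Plane → Plane →L[ℝ] Plane →L[ℝ] ℝ) (q u : Plane × ℝ) :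
    angularForm G q u = u.2 + connectionForm G q.1 u.1 := by
  simp [angularForm]

/-- The angular velocity `α' + ω(c')`, relative to the Levi-Civita connection, of the unit vector
`unitVector G (c, α)` along `c`. -/
def angularVelocity (G : Plane → Plane →L[ℝ] Plane →L[ℝ] ℝ) (c : ℝ → Plane) (α : ℝ → ℝ)
    (s : ℝ) : ℝ :=
  deriv α s + connectionForm G (c s) (deriv c s)

namespace IsRiemannianOn

variable {G : Plane → Plane →L[ℝ] Plane →L[ℝ] ℝ} {Ω : Set Plane} (hG : IsRiemannianOn G Ω)
  {y : Plane}
include hG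

theorem inner_unitVector_frameOne (hy : y ∈ Ω) (α : ℝ) :
    G y (unitVector G (y, α)) (frameOne G y) = Real.cos α := by
  simp [unitVector, hG.frameOne_self hy, hG.frameTwo_frameOne hy]

theorem inner_unitVector_frameTwo (hy : y ∈ Ω) (α : ℝ) :
    G y (unitVector G (y, α)) (frameTwo G y) = Real.sin α := by
  simp [unitVector, hG.frameTwo_self hy, hG.frameOne_frameTwo hy]

theorem inner_unitVector_self (hy : y ∈ Ω) (α : ℝ) :
    G y (unitVector G (y, α)) (unitVector G (y, α)) = 1 := by
  rw [hG.inner_frame hy, hG.inner_unitVector_frameOne hy, hG.inner_unitVector_frameTwo hy]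
  nlinarith [Real.sin_sq_add_cos_sq α]

theorem rotation_unitVector (hy : y ∈ Ω) (α : ℝ) :
    frameRotation G y (unitVector G (y, α)) = unitVector G (y, α + Real.pi / 2) := by
  simp only [unitVector, map_add, map_smul, hG.rotation_frameOne hy, hG.rotation_frameTwo hy,
    Real.cos_add_pi_div_two, Real.sin_add_pi_div_two]
  module

theorem hasFDerivAt_unitVector (hy : y ∈ Ω) (α : ℝ) :
    HasFDerivAt (unitVector G)
      (Real.cos α • (fderiv ℝ (frameOne G) y).comp (ContinuousLinearMap.fst ℝ Plane ℝ)
        + (-Real.sin α • ContinuousLinearMap.snd ℝ Plane ℝ).smulRight (frameOne G y)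
        + (Real.sin α • (fderiv ℝ (frameTwo G) y).comp (ContinuousLinearMap.fst ℝ Plane ℝ)
        + (Real.cos α • ContinuousLinearMap.snd ℝ Plane ℝ).smulRight (frameTwo G y)))
      (y, α) := by
  have h1 : HasFDerivAt (fun q : Plane × ℝ => frameOne G q.1) _ (y, α) :=
    HasFDerivAt.comp (g := frameOne G) (y, α) (hG.differentiableAt_frameOne hy).hasFDerivAt
      hasFDerivAt_fst
  have h2 : HasFDerivAt (fun q : Plane × ℝ => frameTwo G q.1) _ (y, α) :=
    HasFDerivAt.comp (g := frameTwo G) (y, α) (hG.differentiableAt_frameTwo hy).hasFDerivAt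
      hasFDerivAt_fst
  have h3 : HasFDerivAt (fun q : Plane × ℝ => q.2)
      (ContinuousLinearMap.snd ℝ Plane ℝ) (y, α) := hasFDerivAt_snd
  exact (h3.cos.smul h1).add (h3.sin.smul h2)

/-- The vertical part of the derivative of `unitVector`. -/
theorem fderiv_unitVector_add (hy : y ∈ Ω) (α : ℝ) (u : Plane × ℝ) :
    fderiv ℝ (unitVector G) (y, α) u + christoffel G y (unitVector G (y, α)) u.1
      = angularForm G (y, α) u • frameRotation G y (unitVector G (y, α)) := by
  have h1 := hG.covFDeriv_frameOne hy u.1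
  have h2 := hG.covFDeriv_frameTwo hy u.1
  rw [covFDeriv, ← eq_sub_iff_add_eq] at h1 h2
  rw [hG.isMetricOn.christoffel_symm hy, (hG.hasFDerivAt_unitVector hy α).fderiv]
  simp only [unitVector, map_add, map_smul, hG.rotation_frameOne hy, hG.rotation_frameTwo hy,
    angularForm_apply, add_apply, smul_apply, ContinuousLinearMap.comp_apply,
    ContinuousLinearMap.smulRight_apply, ContinuousLinearMap.coe_fst', ContinuousLinearMap.coe_snd',
    h1, h2, smul_eq_mul]
  module

/-- The vertical part is dα + ω times the unit vector Jv, so the fibre term is minus the square of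
this form. This Kaluza-Klein form is the basis of all later computations with the metric. -/
theorem magneticMetric_apply {q : Plane × ℝ} (hq : q.1 ∈ Ω) (u v : Plane × ℝ) :
    magneticMetric G q u v = G q.1 u.1 v.1 - angularForm G q u * angularForm G q v := by
  obtain ⟨y, α⟩ := q
  have h : ∀ u, verticalPart G y (unitVector G (y, α)) (u.1, fderiv ℝ (unitVector G) (y, α) u)
      = angularForm G (y, α) u • frameRotation G y (unitVector G (y, α)) := fun u => by
    rw [← hG.fderiv_unitVector_add hq]
    simp [verticalPart]
  simp only [magneticMetric, splitForm, ContinuousLinearMap.bilinearComp_apply, sub_apply,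
    ContinuousLinearMap.prod_apply, ContinuousLinearMap.coe_fst', h, map_smul, smul_apply,
    hG.inner_rotation_rotation hq, hG.inner_unitVector_self hq]
  simp
  ring

theorem contDiffAt_angularForm {q : Plane × ℝ} (hq : q.1 ∈ Ω) :
    ContDiffAt ℝ ∞ (angularForm G) q :=
  contDiffAt_const.add
    (((hG.contDiffAt_connectionForm hq).comp q contDiffAt_fst).clm_comp contDiffAt_const)

theorem isMetricOn_magneticMetric : IsMetricOn (magneticMetric G) (Prod.fst ⁻¹' Ω) where
  isOpen := hG.isOpen.preimage continuous_fst
  contDiffOn := by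
    have h : ∀ u v, ContDiffOn ℝ ∞ (fun q => magneticMetric G q u v) (Prod.fst ⁻¹' Ω) := by
      intro u v q hq
      have h1 := hG.contDiffAt_angularForm hq
      have h2 : ContDiffAt ℝ ∞ (fun q : Plane × ℝ => G q.1 u.1 v.1
          - angularForm G q u * angularForm G q v) q := by
        refine ContDiffAt.sub ?_ ?_
        · exact (((hG.isMetricOn.contDiffAt hq).comp q contDiffAt_fst).clm_apply
            contDiffAt_const).clm_apply contDiffAt_const
        · exact (h1.clm_apply contDiffAt_const).mul (h1.clm_apply contDiffAt_const)
      exact h2.contDiffWithinAt.congr (fun x hx => hG.magneticMetric_apply hx u v)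
        (hG.magneticMetric_apply hq u v)
    exact contDiffOn_clm_apply.2 fun u => contDiffOn_clm_apply.2 fun v => h u v
  symm q hq u v := by
    rw [hG.magneticMetric_apply hq, hG.magneticMetric_apply hq, hG.symm _ hq]
    ring
  nondegenerate q hq u hu := by
    -- Pairing with the fibre direction kills the angular form of u; pairing with (u.1, 0) then
    -- leaves G(u.1, u.1) = 0.
    have h1 := hu (0, 1)
    rw [hG.magneticMetric_apply hq] at h1
    have h1 : u.2 + connectionForm G q.1 u.1 = 0 := by
      simpa [angularForm_apply, -neg_add_rev] using h1
    have h2 := hu (u.1, 0)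
    rw [hG.magneticMetric_apply hq, angularForm_apply G q u, h1] at h2
    simp at h2
    have h3 := hG.eq_zero_of_self hq h2
    rw [h3] at h1
    exact Prod.ext h3 (by simpa using h1)

/-- The coefficients do not depend on the angle, so only the base component of `d` enters; this
symmetry is the source of the conserved angular velocity. -/
theorem fderiv_magneticMetric {q : Plane × ℝ} (hq : q.1 ∈ Ω) (d u v : Plane × ℝ) :
    fderiv ℝ (magneticMetric G) q d u v = fderiv ℝ G q.1 d.1 u.1 v.1
      - fderiv ℝ (connectionForm G) q.1 d.1 u.1 * angularForm G q v
      - angularForm G q u * fderiv ℝ (connectionForm G) q.1 d.1 v.1 := by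
  have h1 := ((hG.isMetricOn_magneticMetric.differentiableAt hq).hasFDerivAt.clm_apply
    (hasFDerivAt_const u q)).clm_apply (hasFDerivAt_const v q)
  have hGq : HasFDerivAt (fun q : Plane × ℝ => G q.1) _ q :=
    (hG.isMetricOn.differentiableAt hq).hasFDerivAt.comp q hasFDerivAt_fst
  have hω : HasFDerivAt (fun q : Plane × ℝ => connectionForm G q.1) _ q :=
    (hG.differentiableAt_connectionForm hq).hasFDerivAt.comp q hasFDerivAt_fst
  have hη : ∀ u : Plane × ℝ, HasFDerivAt (fun q : Plane × ℝ => angularForm G q u)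
      (((fderiv ℝ (connectionForm G) q.1).flip u.1).comp (ContinuousLinearMap.fst ℝ Plane ℝ)) q := by
    intro u
    simp only [angularForm_apply]
    refine ((hω.clm_apply (hasFDerivAt_const u.1 q)).const_add u.2).congr_fderiv ?_
    ext <;> simp
  have h2 := (((hGq.clm_apply (hasFDerivAt_const u.1 q)).clm_apply
    (hasFDerivAt_const v.1 q)).sub ((hη u).mul (hη v)))
  have h3 : (fun q => magneticMetric G q u v) =ᶠ[𝓝 q] fun q : Plane × ℝ => G q.1 u.1 v.1
      - angularForm G q u * angularForm G q v := by
    filter_upwards [hG.isMetricOn_magneticMetric.mem_nhds hq] with x hx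
      using hG.magneticMetric_apply hx u v
  have h4 := congrArg (fun L : Plane × ℝ →L[ℝ] ℝ => L d)
    (h1.unique (h2.congr_of_eventuallyEq h3))
  simp at h4
  rw [h4]
  ring

theorem differentiableAt_angularVelocity {c : ℝ → Plane} {α : ℝ → ℝ} {t : ℝ} (ht : c t ∈ Ω)
    (hc : ContDiffAt ℝ 2 c t) (hα : ContDiffAt ℝ 2 α t) :
    HasDerivAt (angularVelocity G c α) (deriv (deriv α) t + connectionForm G (c t) (deriv (deriv c) t)
      + fderiv ℝ (connectionForm G) (c t) (deriv c t) (deriv c t)) t := by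
  have h1 : HasDerivAt (deriv α) (deriv (deriv α) t) t :=
    ((hα.derivWithin (m := 1) (by norm_num)).differentiableAt (by simp)).hasDerivAt
  have h2 : HasDerivAt (deriv c) (deriv (deriv c) t) t :=
    ((hc.derivWithin (m := 1) (by norm_num)).differentiableAt (by simp)).hasDerivAt
  have h3 : HasDerivAt (fun s => connectionForm G (c s)) _ t :=
    (hG.differentiableAt_connectionForm ht).hasFDerivAt.comp_hasDerivAt t
      (hc.differentiableAt (by simp)).hasDerivAt
  refine (h1.add (h3.clm_apply h2)).congr_deriv ?_
  ring

/-- The geodesics of the magnetic metric project to the trajectories of a charged particle, whose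
charge is the constant angular velocity. -/
theorem acceleration_magneticMetric_eq_zero_iff {c : ℝ → Plane} {α : ℝ → ℝ} {t : ℝ} (ht : c t ∈ Ω)
    (hc : ContDiffAt ℝ 2 c t) (hα : ContDiffAt ℝ 2 α t) :
    acceleration (magneticMetric G) (fun s => (c s, α s)) t = 0 ↔
      deriv (angularVelocity G c α) t = 0 ∧ acceleration G c t
        = -((coordCurvature G (c t) * angularVelocity G c α t) •
          frameRotation G (c t) (deriv c t)) := by
  have h1 : ∀ᶠ s in 𝓝 t, deriv (fun s => (c s, α s)) s = (deriv c s, deriv α s) := by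
    filter_upwards [hc.eventually (by simp), hα.eventually (by simp)] with s h2 h3
    exact ((h2.differentiableAt (by simp)).hasDerivAt.prodMk
      (h3.differentiableAt (by simp)).hasDerivAt).deriv
  have h2 : deriv (deriv fun s => (c s, α s)) t = (deriv (deriv c) t, deriv (deriv α) t) := by
    rw [Filter.EventuallyEq.deriv_eq h1]
    exact ((((hc.derivWithin (m := 1) (by norm_num)).differentiableAt (by simp)).hasDerivAt).prodMk
      (((hα.derivWithin (m := 1) (by norm_num)).differentiableAt (by simp)).hasDerivAt)).deriv
  rw [hG.isMetricOn_magneticMetric.acceleration_eq_iff (fun s => (c s, α s)) t ht 0,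
    hG.isMetricOn.acceleration_eq_iff c t ht, h1.self_of_nhds, h2,
    (hG.differentiableAt_angularVelocity ht hc hα).deriv]
  set P := deriv (deriv α) t + connectionForm G (c t) (deriv (deriv c) t)
      + fderiv ℝ (connectionForm G) (c t) (deriv c t) (deriv c t) with hP
  -- The Euler-Lagrange expression splits into that of `G`, a multiple of `P` (the derivative of the
  -- angular velocity), and a force term: the remaining derivatives of ω combine into dω(c', b),
  -- which is rewritten by the curvature.
  have key : ∀ b : Plane × ℝ, magneticMetric G (c t, α t) (deriv (deriv c) t, deriv (deriv α) t) b
      + fderiv ℝ (magneticMetric G) (c t, α t) (deriv c t, deriv α t) (deriv c t, deriv α t) b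
      - 1 / 2 * fderiv ℝ (magneticMetric G) (c t, α t) b (deriv c t, deriv α t)
        (deriv c t, deriv α t)
      = (G (c t) (deriv (deriv c) t) b.1 + fderiv ℝ G (c t) (deriv c t) (deriv c t) b.1
        - 1 / 2 * fderiv ℝ G (c t) b.1 (deriv c t) (deriv c t))
        - P * angularForm G (c t, α t) b - G (c t) (-((coordCurvature G (c t)
          * angularVelocity G c α t) • frameRotation G (c t) (deriv c t))) b.1 := by
    intro b
    have hd := hG.connectionForm_differential ht (deriv c t) b.1
    rw [hG.fderiv_magneticMetric (q := (c t, α t)) ht, hG.fderiv_magneticMetric (q := (c t, α t)) ht,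
      hG.magneticMetric_apply (q := (c t, α t)) ht]
    simp only [angularForm_apply, hP, angularVelocity, map_neg, map_smul, neg_apply, smul_apply,
      smul_eq_mul]
    linear_combination (-(deriv α t + connectionForm G (c t) (deriv c t))) * hd
  simp only [key]
  constructor
  · intro h
    -- The fibre direction isolates `P`, as all other terms depend on the base component alone.
    have hP0 : P = 0 := by simpa [angularForm_apply] using h (0, 1)
    refine ⟨hP0, fun b => ?_⟩
    have := h (b, 0)
    rw [hP0] at this
    simp at this
    simp
    linarith
  · rintro ⟨h1, h2⟩ b
    rw [h1, h2]
    simp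

/-- The covariant derivative of a field of unit vectors along a curve. -/
theorem covDeriv_unitVector {c : ℝ → Plane} {α : ℝ → ℝ} {s : ℝ} (hs : c s ∈ Ω)
    (hc : DifferentiableAt ℝ c s) (hα : DifferentiableAt ℝ α s) :
    covDeriv G c (fun s => unitVector G (c s, α s)) s
      = angularVelocity G c α s • frameRotation G (c s) (unitVector G (c s, α s)) := by
  have h1 := (hG.hasFDerivAt_unitVector hs (α s)).differentiableAt.hasFDerivAt
  have h2 : HasDerivAt (fun s => unitVector G (c s, α s))
      (fderiv ℝ (unitVector G) (c s, α s) (deriv c s, deriv α s)) s :=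
    HasFDerivAt.comp_hasDerivAt (l := unitVector G) s h1 (hc.hasDerivAt.prodMk hα.hasDerivAt)
  rw [covDeriv, h2.deriv, hG.fderiv_unitVector_add hs (α s) (deriv c s, deriv α s)]
  simp [angularForm_apply, angularVelocity]

theorem differentiableAt_unitVector {c : ℝ → Plane} {α : ℝ → ℝ} {s : ℝ} (hs : c s ∈ Ω)
    (hc : DifferentiableAt ℝ c s) (hα : DifferentiableAt ℝ α s) :
    DifferentiableAt ℝ (fun s => unitVector G (c s, α s)) s :=
  DifferentiableAt.comp (g := unitVector G) s
    (hG.hasFDerivAt_unitVector hs (α s)).differentiableAt (hc.prodMk hα)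

/-- A smooth field of unit vectors along a curve has a smooth angle. -/
theorem exists_angle {c W : ℝ → Plane} {t : ℝ} (ht : c t ∈ Ω) (hc : ContDiffAt ℝ ∞ c t)
    (hW : ContDiffAt ℝ ∞ W t) (hunit : ∀ᶠ s in 𝓝 t, G (c s) (W s) (W s) = 1) :
    ∃ α : ℝ → ℝ, ContDiffAt ℝ ∞ α t ∧ ∀ᶠ s in 𝓝 t, W s = unitVector G (c s, α s) := by
  have hmem : ∀ᶠ s in 𝓝 t, c s ∈ Ω := hc.continuousAt.eventually_mem (hG.isMetricOn.mem_nhds ht)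
  have ha : ContDiffAt ℝ ∞ (fun s => G (c s) (W s) (frameOne G (c s))) t :=
    (((hG.isMetricOn.contDiffAt ht).comp t hc).clm_apply hW).clm_apply
      ((hG.contDiffAt_frameOne ht).comp t hc)
  have hb : ContDiffAt ℝ ∞ (fun s => G (c s) (W s) (frameTwo G (c s))) t :=
    (((hG.isMetricOn.contDiffAt ht).comp t hc).clm_apply hW).clm_apply
      ((hG.contDiffAt_frameTwo ht).comp t hc)
  -- The frame components of the unit field, as a curve in the unit circle.
  set f : ℝ → ℂ := fun s => G (c s) (W s) (frameOne G (c s))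
    + G (c s) (W s) (frameTwo G (c s)) * Complex.I with hf
  have hfs : ContDiffAt ℝ ∞ f t :=
    (Complex.ofRealCLM.contDiff.contDiffAt.comp t ha).add
      ((Complex.ofRealCLM.contDiff.contDiffAt.comp t hb).mul contDiffAt_const)
  have hnorm : ∀ᶠ s in 𝓝 t, ‖f s‖ = 1 := by
    filter_upwards [hunit, hmem] with s hs hs'
    rw [hf, Complex.norm_add_mul_I, Real.sqrt_eq_one, ← hs, hG.inner_frame hs' (W s) (W s)]
    ring
  have hft : ‖f t‖ = 1 := hnorm.self_of_nhds
  have hf0 : f t ≠ 0 := fun h => by simp [h] at hft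
  -- Dividing by `f t` moves the base value to 1, away from the branch cut of the logarithm; `arg (f
  -- t)` restores the angle afterwards.
  have hlog : ContDiffAt ℝ ∞ (fun s => Complex.log (f s / f t)) t := by
    have h1 : ContDiffAt ℝ ∞ Complex.log (f t / f t) := by
      rw [div_self hf0]
      exact (Complex.contDiffAt_log Complex.one_mem_slitPlane).restrict_scalars ℝ
    exact ContDiffAt.comp t h1 (hfs.div_const _)
  refine ⟨fun s => Complex.arg (f t) + (Complex.log (f s / f t)).im, contDiffAt_const.add
    (Complex.imCLM.contDiff.contDiffAt.comp t hlog), ?_⟩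
  filter_upwards [hnorm, hmem] with s hs hs'
  have hfs0 : f s ≠ 0 := fun h => by simp [h] at hs
  have key : Complex.exp ((Complex.arg (f t) + (Complex.log (f s / f t)).im : ℝ) * Complex.I)
      = f s := by
    rw [Complex.log_im, Complex.ofReal_add, add_mul, Complex.exp_add]
    have e1 := Complex.norm_mul_exp_arg_mul_I (f t)
    have e2 := Complex.norm_mul_exp_arg_mul_I (f s / f t)
    rw [norm_div, hs, hft] at e2
    rw [hft] at e1
    simp at e1 e2
    rw [e1, e2, mul_div_cancel₀ _ hf0]
  rw [Complex.exp_mul_I, ← Complex.ofReal_cos, ← Complex.ofReal_sin] at key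
  have hre := congrArg Complex.re key
  have him := congrArg Complex.im key
  have hfre : (f s).re = G (c s) (W s) (frameOne G (c s)) := by simp [hf]
  have hfim : (f s).im = G (c s) (W s) (frameTwo G (c s)) := by simp [hf]
  simp only [Complex.add_re, Complex.add_im, Complex.ofReal_re, Complex.ofReal_im, Complex.mul_re,
    Complex.mul_im, Complex.I_re, Complex.I_im, hfre, hfim, mul_zero, mul_one, sub_zero, add_zero,
    zero_add] at hre him
  rw [hG.frame_expand hs' (W s), unitVector]
  simp only [hre, him]

end IsRiemannianOn

end MagneticCoordinates

/-! ### Coordinates on the surface and on its tangent bundle -/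

section SurfaceCoordinates

variable {S : Type*} [TopologicalSpace S] [ChartedSpace Plane S] {x₀ x₁ x : S}

/-- The change of coordinates from the preferred chart at `x₀` to the one at `x₁`. -/
def transition (x₀ x₁ : S) (y : Plane) : Plane :=
  extChartAt (𝓡 2) x₁ ((extChartAt (𝓡 2) x₀).symm y)

theorem transition_apply (hx : x ∈ (chartAt Plane x₀).source) :
    transition x₀ x₁ (extChartAt (𝓡 2) x₀ x) = extChartAt (𝓡 2) x₁ x := by
  rw [transition, (extChartAt (𝓡 2) x₀).left_inv (by simpa using hx)]

theorem eventually_mem_source_symm (hx : x ∈ (chartAt Plane x₀).source)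
    (hx' : x ∈ (chartAt Plane x₁).source) : ∀ᶠ y in 𝓝 (extChartAt (𝓡 2) x₀ x), ∃ x' : S,
      x' ∈ (chartAt Plane x₀).source ∧ x' ∈ (chartAt Plane x₁).source
        ∧ y = extChartAt (𝓡 2) x₀ x' := by
  have h1 : x ∈ (extChartAt (𝓡 2) x₀).source := by simpa using hx
  have h2 : ContinuousAt (extChartAt (𝓡 2) x₀).symm (extChartAt (𝓡 2) x₀ x) :=
    continuousAt_extChartAt_symm' h1
  rw [ContinuousAt, (extChartAt (𝓡 2) x₀).left_inv h1] at h2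
  filter_upwards [h2 ((chartAt Plane x₁).open_source.mem_nhds hx'),
    (isOpen_extChartAt_target x₀).mem_nhds ((extChartAt (𝓡 2) x₀).map_source h1)] with y hy1 hy2
  exact ⟨(extChartAt (𝓡 2) x₀).symm y, by simpa using (extChartAt (𝓡 2) x₀).map_target hy2, hy1,
    ((extChartAt (𝓡 2) x₀).right_inv hy2).symm⟩

theorem extChartAt_mem_target (hx : x ∈ (chartAt Plane x₀).source) :
    extChartAt (𝓡 2) x₀ x ∈ (extChartAt (𝓡 2) x₀).target :=
  (extChartAt (𝓡 2) x₀).map_source (by simpa using hx)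

variable [IsManifold (𝓡 2) ∞ S]

/-- The metric, as a bilinear form on the coordinate space of the preferred chart. -/
def metricAt (h : SurfaceMetric S) (x : S) : Plane →L[ℝ] Plane →L[ℝ] ℝ := h.inner x

/-- The tangent vector at `x` with given coordinates in the preferred chart at `x₀`. -/
def frameAt (x₀ x : S) : Plane →L[ℝ] Plane := tangentCoordChange (𝓡 2) x₀ x x

/-- The coordinates, in the preferred chart at `x₀`, of the base point of a tangent vector. -/
def baseCoord (x₀ : S) (p : TangentBundle (𝓡 2) S) : Plane := extChartAt (𝓡 2) x₀ p.1

/-- The coordinates of a tangent vector with respect to the preferred chart at `x₀`. -/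
def fiberCoord (x₀ : S) (p : TangentBundle (𝓡 2) S) : Plane :=
  (trivializationAt Plane (TangentSpace (𝓡 2)) x₀ p).2

/-- A tangent vector, as an element of the coordinate space of the preferred chart. -/
def fiberVector (p : TangentBundle (𝓡 2) S) : Plane := p.2

theorem fiberCoord_eq (x₀ : S) (p : TangentBundle (𝓡 2) S) :
    fiberCoord x₀ p = tangentCoordChange (𝓡 2) p.1 x₀ p.1 (fiberVector p) := rfl

theorem metricAt_symm (h : SurfaceMetric S) (x : S) (v w : Plane) :
    metricAt h x v w = metricAt h x w v := h.symm x v w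

theorem metricAt_pos (h : SurfaceMetric S) (x : S) {v : Plane} (hv : v ≠ 0) :
    0 < metricAt h x v v := h.pos x v hv

theorem eq_zero_of_metricAt_self (h : SurfaceMetric S) (x : S) {v : Plane}
    (hv : metricAt h x v v = 0) : v = 0 := by
  by_contra h0
  exact (metricAt_pos h x h0).ne' hv

theorem frameAt_self (x : S) (v : Plane) : frameAt x x v = v :=
  tangentCoordChange_self (mem_extChartAt_source x)

/-- The cocycle relation for coordinate changes; with `fiberCoord_frameAt` it makes the two maps
inverse to each other over the chart domain. -/
theorem frameAt_fiberCoord {p : TangentBundle (𝓡 2) S} (hp : p.1 ∈ (chartAt Plane x₀).source) :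
    frameAt x₀ p.1 (fiberCoord x₀ p) = fiberVector p := by
  rw [frameAt, fiberCoord_eq, tangentCoordChange_comp, tangentCoordChange_self]
  · exact mem_extChartAt_source _
  · simp [hp]

theorem fiberCoord_frameAt (hx : x ∈ (chartAt Plane x₀).source) (w : Plane) :
    fiberCoord x₀ ⟨x, frameAt x₀ x w⟩ = w := by
  rw [fiberCoord_eq, fiberVector, frameAt, tangentCoordChange_comp, tangentCoordChange_self]
  · simp [hx]
  · simp [hx]

theorem frameAt_injective (hx : x ∈ (chartAt Plane x₀).source) :
    Function.Injective (frameAt x₀ x) := fun v w hvw => by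
  rw [← fiberCoord_frameAt hx v, hvw, fiberCoord_frameAt hx]

theorem frameAt_comp {x₁ : S} (hx : x ∈ (chartAt Plane x₀).source)
    (hx' : x ∈ (chartAt Plane x₁).source) (w : Plane) :
    frameAt x₁ x (tangentCoordChange (𝓡 2) x₀ x₁ x w) = frameAt x₀ x w := by
  rw [frameAt, tangentCoordChange_comp, frameAt]
  simp [hx, hx']

theorem symmL_eq_frameAt (hx : x ∈ (chartAt Plane x₀).source) :
    (trivializationAt Plane (TangentSpace (𝓡 2)) x₀).symmL ℝ x = frameAt x₀ x :=
  TangentBundle.symmL_trivializationAt_eq_core hx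

theorem chartMetric_apply (h : SurfaceMetric S) (hx : x ∈ (chartAt Plane x₀).source)
    (v w : Plane) :
    chartMetric h x₀ (extChartAt (𝓡 2) x₀ x) v w
      = metricAt h x (frameAt x₀ x v) (frameAt x₀ x w) := by
  have hx' : (extChartAt (𝓡 2) x₀).symm (extChartAt (𝓡 2) x₀ x) = x :=
    (extChartAt (𝓡 2) x₀).left_inv (by simpa using hx)
  have h1 : ∀ x' : S, x' = x →
      (metricAt h x').bilinearComp ((trivializationAt Plane (TangentSpace (𝓡 2)) x₀).symmL ℝ x')
        ((trivializationAt Plane (TangentSpace (𝓡 2)) x₀).symmL ℝ x') v w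
      = metricAt h x (frameAt x₀ x v) (frameAt x₀ x w) := by
    rintro x' rfl
    have h2 : ∀ v, (trivializationAt Plane (TangentSpace (𝓡 2)) x₀).symmL ℝ x' v
        = frameAt x₀ x' v := fun v =>
      congrArg (fun L : Plane →L[ℝ] Plane => L v) (symmL_eq_frameAt hx)
    exact congrArg₂ (fun a b : Plane => metricAt h x' a b) (h2 v) (h2 w)
  exact h1 _ hx'

theorem chartMetric_self (h : SurfaceMetric S) (x : S) :
    chartMetric h x (extChartAt (𝓡 2) x x) = metricAt h x := by
  ext v w
  rw [chartMetric_apply h (mem_chart_source _ x), frameAt_self, frameAt_self]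

/-- Each matrix entry is the smooth bundle metric evaluated on two coordinate fields, which are
smooth because the inverse of the trivialization is. -/
theorem contDiffOn_chartMetric (h : SurfaceMetric S) (x₀ : S) :
    ContDiffOn ℝ ∞ (chartMetric h x₀) (extChartAt (𝓡 2) x₀).target := by
  refine contDiffOn_clm_apply.2 fun v => contDiffOn_clm_apply.2 fun w => ?_
  rw [← contMDiffOn_iff_contDiffOn]
  intro y hy
  have hsymm : ContMDiffAt 𝓘(ℝ, Plane) (𝓡 2) ∞ (extChartAt (𝓡 2) x₀).symm y :=
    (contMDiffOn_extChartAt_symm x₀).contMDiffAt ((isOpen_extChartAt_target x₀).mem_nhds hy)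
  have hsec : ∀ v : Plane, ContMDiffAt 𝓘(ℝ, Plane) (𝓡 2).tangent ∞
      (fun y => (⟨(extChartAt (𝓡 2) x₀).symm y,
        (trivializationAt Plane (TangentSpace (𝓡 2)) x₀).symmL ℝ
          ((extChartAt (𝓡 2) x₀).symm y) v⟩ : TangentBundle (𝓡 2) S)) y := by
    intro v
    have hmem : ∀ y ∈ (extChartAt (𝓡 2) x₀).target, (extChartAt (𝓡 2) x₀).symm y
        ∈ (trivializationAt Plane (TangentSpace (𝓡 2)) x₀).baseSet := fun y hy => by
      simpa using (extChartAt (𝓡 2) x₀).map_target hy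
    have h1 : ContMDiffAt 𝓘(ℝ, Plane) ((𝓡 2).prod 𝓘(ℝ, Plane)) ∞
        (fun y => ((extChartAt (𝓡 2) x₀).symm y, v)) y := hsymm.prodMk contMDiffAt_const
    have h2 := ((trivializationAt Plane (TangentSpace (𝓡 2) : S → Type _) x₀).contMDiffOn_symm
      (IB := 𝓡 2) (n := ∞)).contMDiffAt
      ((trivializationAt Plane (TangentSpace (𝓡 2) : S → Type _) x₀).open_target.mem_nhds
        (x := ((extChartAt (𝓡 2) x₀).symm y, v))
        ((Bundle.Trivialization.mem_target _).2 (hmem y hy)))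
    refine (h2.comp y h1).congr_of_eventuallyEq ?_
    filter_upwards [(isOpen_extChartAt_target x₀).mem_nhds hy] with y' hy'
    rw [Bundle.Trivialization.symmL_apply _ (hmem y' hy'), Bundle.Trivialization.mk_symm _ (hmem y' hy')]
    rfl
  have key : ContMDiffAt 𝓘(ℝ, Plane) ((𝓡 2).prod 𝓘(ℝ, ℝ)) ∞
      (fun y => Bundle.TotalSpace.mk' ℝ (E := Bundle.Trivial S ℝ) ((extChartAt (𝓡 2) x₀).symm y)
        (h.inner ((extChartAt (𝓡 2) x₀).symm y)
          ((trivializationAt Plane (TangentSpace (𝓡 2)) x₀).symmL ℝ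
            ((extChartAt (𝓡 2) x₀).symm y) v)
          ((trivializationAt Plane (TangentSpace (𝓡 2)) x₀).symmL ℝ
            ((extChartAt (𝓡 2) x₀).symm y) w))) y := by
    apply ContMDiffAt.clm_bundle_apply₂ (F₁ := Plane) (F₂ := Plane)
    · exact ContMDiffAt.comp y h.contMDiff.contMDiffAt hsymm
    · exact hsec v
    · exact hsec w
  simp only [Bundle.contMDiffAt_totalSpace] at key
  exact key.2.contMDiffWithinAt

theorem isRiemannianOn_chartMetric (h : SurfaceMetric S) (x₀ : S) :
    IsRiemannianOn (chartMetric h x₀) (extChartAt (𝓡 2) x₀).target where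
  isOpen := isOpen_extChartAt_target x₀
  contDiffOn := contDiffOn_chartMetric h x₀
  symm y hy v w := by
    have hx : (extChartAt (𝓡 2) x₀).symm y ∈ (chartAt Plane x₀).source := by
      simpa using (extChartAt (𝓡 2) x₀).map_target hy
    rw [← (extChartAt (𝓡 2) x₀).right_inv hy, chartMetric_apply h hx, chartMetric_apply h hx,
      metricAt_symm]
  pos y hy v hv := by
    have hx : (extChartAt (𝓡 2) x₀).symm y ∈ (chartAt Plane x₀).source := by
      simpa using (extChartAt (𝓡 2) x₀).map_target hy
    rw [← (extChartAt (𝓡 2) x₀).right_inv hy, chartMetric_apply h hx]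
    refine metricAt_pos h _ fun h0 => hv (frameAt_injective hx ?_)
    rw [h0, map_zero]

theorem contDiffAt_transition (hx : x ∈ (chartAt Plane x₀).source)
    (hx' : x ∈ (chartAt Plane x₁).source) :
    ContDiffAt ℝ ∞ (transition x₀ x₁) (extChartAt (𝓡 2) x₀ x) := by
  have h := contDiffWithinAt_ext_coord_change (I := 𝓡 2) (n := ∞) x₁ x₀
    (y := extChartAt (𝓡 2) x₀ x) (by
      have : x ∈ (extChartAt (𝓡 2) x₀).source := by simpa using hx
      rw [PartialEquiv.trans_source]
      refine ⟨(extChartAt (𝓡 2) x₀).map_source this, ?_⟩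
      rw [Set.mem_preimage, (extChartAt (𝓡 2) x₀).left_inv this]
      simpa using hx')
  simpa [contDiffWithinAt_univ] using! h

theorem fderiv_transition (x₀ x₁ x : S) :
    fderiv ℝ (transition x₀ x₁) (extChartAt (𝓡 2) x₀ x) = tangentCoordChange (𝓡 2) x₀ x₁ x := by
  rw [tangentCoordChange_def]
  simp
  rfl

theorem fiberCoord_transition {p : TangentBundle (𝓡 2) S} (hp : p.1 ∈ (chartAt Plane x₀).source)
    (hp' : p.1 ∈ (chartAt Plane x₁).source) :
    fiberCoord x₁ p = fderiv ℝ (transition x₀ x₁) (baseCoord x₀ p) (fiberCoord x₀ p) := by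
  rw [baseCoord, fderiv_transition, fiberCoord_eq, fiberCoord_eq, tangentCoordChange_comp]
  simp [hp, hp']

/-- Both chart metrics represent the same `h`, so the change of charts is an isometry between them
and `christoffel_pullback` applies. -/
theorem christoffel_transition (h : SurfaceMetric S) (hx : x ∈ (chartAt Plane x₀).source)
    (hx' : x ∈ (chartAt Plane x₁).source) (u v : Plane) :
    fderiv ℝ (transition x₀ x₁) (extChartAt (𝓡 2) x₀ x)
        (christoffel (chartMetric h x₀) (extChartAt (𝓡 2) x₀ x) u v)
      = fderiv ℝ (fderiv ℝ (transition x₀ x₁)) (extChartAt (𝓡 2) x₀ x) u v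
        + christoffel (chartMetric h x₁) (extChartAt (𝓡 2) x₁ x)
          (fderiv ℝ (transition x₀ x₁) (extChartAt (𝓡 2) x₀ x) u)
          (fderiv ℝ (transition x₀ x₁) (extChartAt (𝓡 2) x₀ x) v) := by
  have hs := christoffel_pullback (isRiemannianOn_chartMetric h x₀).isMetricOn
    (isRiemannianOn_chartMetric h x₁).isMetricOn (φ := transition x₀ x₁)
    (x := extChartAt (𝓡 2) x₀ x) (extChartAt_mem_target hx) (by
      rw [transition_apply hx]
      exact extChartAt_mem_target hx') ((contDiffAt_transition hx hx').of_le two_le_infty) (by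
      intro v
      refine ⟨tangentCoordChange (𝓡 2) x₁ x₀ x v, ?_⟩
      rw [fderiv_transition, tangentCoordChange_comp, tangentCoordChange_self]
      · simpa using hx'
      · simp [hx, hx']) (by
      filter_upwards [eventually_mem_source_symm hx hx'] with y hy v w
      obtain ⟨x', h1, h2, rfl⟩ := hy
      rw [transition_apply h1, chartMetric_apply h h1, chartMetric_apply h h2, fderiv_transition,
        frameAt_comp h1 h2, frameAt_comp h1 h2]) u v
  rwa [transition_apply hx] at hs

/-! #### Curves in the tangent bundle -/

variable {Γ : ℝ → TangentBundle (𝓡 2) S} {s : ℝ}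

theorem contDiffAt_baseCoord (hΓ : ContMDiffAt 𝓘(ℝ, ℝ) (𝓡 2).tangent ∞ Γ s)
    (hs : (Γ s).1 ∈ (chartAt Plane x₀).source) :
    ContDiffAt ℝ ∞ (fun σ => baseCoord x₀ (Γ σ)) s := by
  rw [← contMDiffAt_iff_contDiffAt]
  have h1 := ((trivializationAt Plane (TangentSpace (𝓡 2)) x₀).contMDiffAt_iff (IB := 𝓡 2)
    (by simpa using hs)).1 hΓ
  exact ContMDiffAt.comp s (contMDiffAt_extChartAt' hs) h1.1

theorem contDiffAt_fiberCoord (hΓ : ContMDiffAt 𝓘(ℝ, ℝ) (𝓡 2).tangent ∞ Γ s)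
    (hs : (Γ s).1 ∈ (chartAt Plane x₀).source) :
    ContDiffAt ℝ ∞ (fun σ => fiberCoord x₀ (Γ σ)) s := by
  rw [← contMDiffAt_iff_contDiffAt]
  exact (((trivializationAt Plane (TangentSpace (𝓡 2)) x₀).contMDiffAt_iff (IB := 𝓡 2)
    (by simpa using hs)).1 hΓ).2

theorem liftVelocity_eq (hΓ : ContMDiffAt 𝓘(ℝ, ℝ) (𝓡 2).tangent ∞ Γ s) :
    liftVelocity Γ s = (deriv (fun σ => baseCoord (Γ s).1 (Γ σ)) s,
      deriv (fun σ => fiberCoord (Γ s).1 (Γ σ)) s) := by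
  have h1 : MDifferentiableAt 𝓘(ℝ, ℝ) (𝓡 2).tangent Γ s := hΓ.mdifferentiableAt (by simp)
  have h2 : liftVelocity Γ s
      = fderiv ℝ (fun σ => (baseCoord (Γ s).1 (Γ σ), fiberCoord (Γ s).1 (Γ σ))) s 1 := by
    rw [liftVelocity, h1.mfderiv]
    simp only [writtenInExtChartAt, FiberBundle.extChartAt]
    simp
    rfl
  rw [h2, ((((contDiffAt_baseCoord hΓ (mem_chart_source _ _)).differentiableAt
    (by simp)).hasFDerivAt).prodMk ((contDiffAt_fiberCoord hΓ
    (mem_chart_source _ _)).differentiableAt (by simp)).hasFDerivAt).fderiv]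
  rfl

theorem velocity_eq (hΓ : ContMDiffAt 𝓘(ℝ, ℝ) (𝓡 2).tangent ∞ Γ s) :
    velocity (fun σ => (Γ σ).1) s = deriv (fun σ => baseCoord (Γ s).1 (Γ σ)) s := by
  have h1 : MDifferentiableAt 𝓘(ℝ, ℝ) (𝓡 2) (fun σ => (Γ σ).1) s :=
    (((trivializationAt Plane (TangentSpace (𝓡 2)) (Γ s).1).contMDiffAt_iff (IB := 𝓡 2)
    (by simp)).1 hΓ).1.mdifferentiableAt (by simp)
  rw [velocity, h1.mfderiv]
  simp only [writtenInExtChartAt]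
  simp
  rfl

theorem velocity_eq_liftVelocity (hΓ : ContMDiffAt 𝓘(ℝ, ℝ) (𝓡 2).tangent ∞ Γ s) :
    velocity (fun σ => (Γ σ).1) s = (liftVelocity Γ s).1 := by
  rw [velocity_eq hΓ, liftVelocity_eq hΓ]

theorem eventually_mem_source (hΓ : ContMDiffAt 𝓘(ℝ, ℝ) (𝓡 2).tangent ∞ Γ s)
    (hs : (Γ s).1 ∈ (chartAt Plane x₀).source) :
    ∀ᶠ σ in 𝓝 s, (Γ σ).1 ∈ (chartAt Plane x₀).source := by
  have h1 := (((trivializationAt Plane (TangentSpace (𝓡 2)) x₀).contMDiffAt_iff (IB := 𝓡 2)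
    (by simpa using hs)).1 hΓ).1.continuousAt
  exact h1 ((chartAt Plane x₀).open_source.mem_nhds hs)

theorem hasDerivAt_baseCoord_transition (hΓ : ContMDiffAt 𝓘(ℝ, ℝ) (𝓡 2).tangent ∞ Γ s)
    (hs : (Γ s).1 ∈ (chartAt Plane x₀).source) (hs' : (Γ s).1 ∈ (chartAt Plane x₁).source) :
    deriv (fun σ => baseCoord x₁ (Γ σ)) s = fderiv ℝ (transition x₀ x₁) (baseCoord x₀ (Γ s))
      (deriv (fun σ => baseCoord x₀ (Γ σ)) s) := by
  have h1 : (fun σ => baseCoord x₁ (Γ σ)) =ᶠ[𝓝 s]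
      fun σ => transition x₀ x₁ (baseCoord x₀ (Γ σ)) := by
    filter_upwards [eventually_mem_source hΓ hs] with σ hσ
    exact (transition_apply hσ).symm
  rw [h1.deriv_eq]
  exact (((contDiffAt_transition hs hs').differentiableAt (by simp)).hasFDerivAt.comp_hasDerivAt s
    ((contDiffAt_baseCoord hΓ hs).differentiableAt (by simp)).hasDerivAt).deriv

/-- The fibre coordinates change by the differential of the transition map at the moving base point;
differentiating that factor creates the second-order term. -/
theorem hasDerivAt_fiberCoord_transition (hΓ : ContMDiffAt 𝓘(ℝ, ℝ) (𝓡 2).tangent ∞ Γ s)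
    (hs : (Γ s).1 ∈ (chartAt Plane x₀).source) (hs' : (Γ s).1 ∈ (chartAt Plane x₁).source) :
    deriv (fun σ => fiberCoord x₁ (Γ σ)) s
      = fderiv ℝ (fderiv ℝ (transition x₀ x₁)) (baseCoord x₀ (Γ s))
          (deriv (fun σ => baseCoord x₀ (Γ σ)) s) (fiberCoord x₀ (Γ s))
        + fderiv ℝ (transition x₀ x₁) (baseCoord x₀ (Γ s))
          (deriv (fun σ => fiberCoord x₀ (Γ σ)) s) := by
  have h1 : (fun σ => fiberCoord x₁ (Γ σ)) =ᶠ[𝓝 s]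
      fun σ => fderiv ℝ (transition x₀ x₁) (baseCoord x₀ (Γ σ)) (fiberCoord x₀ (Γ σ)) := by
    filter_upwards [eventually_mem_source hΓ hs, eventually_mem_source hΓ hs'] with σ hσ hσ'
    exact fiberCoord_transition hσ hσ'
  have h2 : DifferentiableAt ℝ (fderiv ℝ (transition x₀ x₁)) (baseCoord x₀ (Γ s)) :=
    (((contDiffAt_transition hs hs').of_le two_le_infty).fderiv_right (m := 1)
      (by norm_num)).differentiableAt (by simp)
  rw [h1.deriv_eq]
  exact ((h2.hasFDerivAt.comp_hasDerivAt s
    ((contDiffAt_baseCoord hΓ hs).differentiableAt (by simp)).hasDerivAt).clm_apply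
    ((contDiffAt_fiberCoord hΓ hs).differentiableAt (by simp)).hasDerivAt).deriv

/-- The horizontal part of the velocity, in the coordinates of any chart. -/
theorem liftVelocity_fst (hΓ : ContMDiffAt 𝓘(ℝ, ℝ) (𝓡 2).tangent ∞ Γ s)
    (hs : (Γ s).1 ∈ (chartAt Plane x₀).source) :
    (liftVelocity Γ s).1 = frameAt x₀ (Γ s).1 (deriv (fun σ => baseCoord x₀ (Γ σ)) s) := by
  rw [liftVelocity_eq hΓ, hasDerivAt_baseCoord_transition hΓ hs (mem_chart_source _ _), baseCoord,
    fderiv_transition, frameAt]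

/-- The vertical part of the velocity of a vector field along a curve is the covariant derivative
of this field, in the coordinates of any chart. -/
theorem vertical_liftVelocity (h : SurfaceMetric S)
    (hΓ : ContMDiffAt 𝓘(ℝ, ℝ) (𝓡 2).tangent ∞ Γ s)
    (hs : (Γ s).1 ∈ (chartAt Plane x₀).source) :
    vertical h (Γ s) (liftVelocity Γ s) = frameAt x₀ (Γ s).1
      (covDeriv (chartMetric h x₀) (fun σ => baseCoord x₀ (Γ σ)) (fun σ => fiberCoord x₀ (Γ σ))
        s) := by
  have hs' := mem_chart_source Plane (Γ s).1
  have h1 : fiberVector (Γ s) = fderiv ℝ (transition x₀ (Γ s).1) (baseCoord x₀ (Γ s))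
      (fiberCoord x₀ (Γ s)) := by
    rw [baseCoord, fderiv_transition]
    exact (frameAt_fiberCoord hs).symm
  have h2 : frameAt x₀ (Γ s).1 = fderiv ℝ (transition x₀ (Γ s).1) (baseCoord x₀ (Γ s)) := by
    rw [baseCoord, fderiv_transition, frameAt]
  have hsymm : IsSymmSndFDerivAt ℝ (transition x₀ (Γ s).1) (baseCoord x₀ (Γ s)) :=
    ((contDiffAt_transition hs hs').of_le two_le_infty).isSymmSndFDerivAt (by simp)
  rw [liftVelocity_eq hΓ, hasDerivAt_baseCoord_transition hΓ hs hs',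
    hasDerivAt_fiberCoord_transition hΓ hs hs', h2, covDeriv, map_add]
  simp only [vertical, verticalPart, add_apply, ContinuousLinearMap.comp_apply,
    ContinuousLinearMap.coe_fst', ContinuousLinearMap.coe_snd']
  rw [show christoffel (chartMetric h (Γ s).1) (extChartAt (𝓡 2) (Γ s).1 (Γ s).1) (Γ s).2
    = christoffel (chartMetric h (Γ s).1) (extChartAt (𝓡 2) (Γ s).1 (Γ s).1)
      (fderiv ℝ (transition x₀ (Γ s).1) (baseCoord x₀ (Γ s)) (fiberCoord x₀ (Γ s))) by rw [← h1, fiberVector]]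
  have h3 := christoffel_transition h hs hs' (fiberCoord x₀ (Γ s))
    (deriv (fun σ => baseCoord x₀ (Γ σ)) s)
  rw [← baseCoord] at h3
  -- The second-order term of the fibre velocity is, by symmetry of the second derivative, exactly
  -- the inhomogeneous term in the law for the Christoffel symbols.
  rw [h3, hsymm.eq]
  abel

end SurfaceCoordinates

/-! ### Moving frames along curves -/

namespace IsRiemannianOn

set_option synthInstance.maxHeartbeats 200000

variable {G : Plane → Plane →L[ℝ] Plane →L[ℝ] ℝ} {Ω : Set Plane} (hG : IsRiemannianOn G Ω)
include hG

/-- The product rule, where the unit vector v along c has covariant derivative p Jv for its angular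
velocity p. -/
theorem hasDerivAt_inner_unitVector {c : ℝ → Plane} {α : ℝ → ℝ} {t : ℝ} (ht : c t ∈ Ω)
    (hc : ContDiffAt ℝ 2 c t) (hα : DifferentiableAt ℝ α t) :
    HasDerivAt (fun s => G (c s) (deriv c s) (unitVector G (c s, α s)))
      (G (c t) (acceleration G c t) (unitVector G (c t, α t))
        + angularVelocity G c α t
          * G (c t) (deriv c t) (frameRotation G (c t) (unitVector G (c t, α t)))) t := by
  have hd := hc.differentiableAt (by simp)
  have h := hG.isMetricOn.hasDerivAt_inner ht hd
    ((hc.derivWithin (m := 1) (by norm_num)).differentiableAt (by simp))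
    (hG.differentiableAt_unitVector ht hd hα)
  rw [hG.covDeriv_unitVector ht hd hα, ← acceleration_eq_covDeriv] at h
  simpa using h

theorem hasDerivAt_inner_rotation_unitVector {c : ℝ → Plane} {α : ℝ → ℝ} {t : ℝ} (ht : c t ∈ Ω)
    (hc : ContDiffAt ℝ 2 c t) (hα : DifferentiableAt ℝ α t) :
    HasDerivAt (fun s => G (c s) (deriv c s) (frameRotation G (c s) (unitVector G (c s, α s))))
      (G (c t) (acceleration G c t) (frameRotation G (c t) (unitVector G (c t, α t)))
        - angularVelocity G c α t * G (c t) (deriv c t) (unitVector G (c t, α t))) t := by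
  -- Jv is the unit vector with angle α + π/2, and it has the same angular velocity as v.
  have h := hG.hasDerivAt_inner_unitVector ht hc (α := fun s => α s + Real.pi / 2)
    (hα.add_const _)
  have hv : angularVelocity G c (fun s => α s + Real.pi / 2) t = angularVelocity G c α t := by
    simp [angularVelocity]
  have he : (fun s => G (c s) (deriv c s) (frameRotation G (c s) (unitVector G (c s, α s))))
      =ᶠ[𝓝 t] fun s => G (c s) (deriv c s) (unitVector G (c s, α s + Real.pi / 2)) := by
    filter_upwards [hc.continuousAt.eventually_mem (hG.isMetricOn.mem_nhds ht)] with s hs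
    rw [hG.rotation_unitVector hs]
  refine (h.congr_of_eventuallyEq he).congr_deriv ?_
  rw [hv, ← hG.rotation_unitVector ht, hG.rotation_rotation ht]
  simp
  ring

/-- Any orthogonal complex structure is the rotation of the frame, up to sign. -/
theorem eq_smul_frameRotation {y : Plane} (hy : y ∈ Ω) {K : Plane → Plane} (hlin : IsLinearMap ℝ K)
    (hK : ∀ v, K (K v) = -v) (hiso : ∀ v w, G y (K v) (K w) = G y v w) :
    G y (K (frameOne G y)) (frameTwo G y) * G y (K (frameOne G y)) (frameTwo G y) = 1 ∧
      ∀ w, K w = G y (K (frameOne G y)) (frameTwo G y) • frameRotation G y w := by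
  have h0 : G y (K (frameOne G y)) (frameOne G y) = 0 := by
    have h := hiso (K (frameOne G y)) (frameOne G y)
    rw [hK, map_neg, neg_apply, hG.symm y hy (frameOne G y)] at h
    linarith
  have h1 := hG.frame_expand hy (K (frameOne G y))
  rw [h0, zero_smul, zero_add] at h1
  set ε := G y (K (frameOne G y)) (frameTwo G y) with hε
  have h2 : ε * ε = 1 := by
    have h := hiso (frameOne G y) (frameOne G y)
    rw [h1] at h
    simpa [hG.frameOne_self hy, hG.frameTwo_self hy] using h
  refine ⟨h2, fun w => ?_⟩
  have h3 : K (frameTwo G y) = -(ε • frameOne G y) := by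
    have h := hK (frameOne G y)
    rw [h1, hlin.map_smul] at h
    calc K (frameTwo G y) = (ε * ε) • K (frameTwo G y) := by rw [h2, one_smul]
      _ = _ := by rw [mul_smul, h, smul_neg]
  conv_lhs => rw [hG.frame_expand hy w]
  rw [hlin.map_add, hlin.map_smul, hlin.map_smul, h1, h3, frameRotation_apply]
  module

/-- Equality is tested on the orthonormal basis (W, JW). The terms in p alone, present on both
sides, come from the turning of this basis: with them, the left-hand sides have the form of the
derivatives of the components of the velocity. -/
theorem eq_smul_rotation_iff {y W : Plane} (hy : y ∈ Ω) (hW : G y W W = 1) (A v : Plane)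
    (κ p : ℝ) : A = -((κ * p) • frameRotation G y v) ↔
      G y A W + p * G y v (frameRotation G y W)
        = p * (1 + κ) * G y v (frameRotation G y W) ∧
      G y A (frameRotation G y W) - p * G y v W = -(p * (1 + κ) * G y v W) := by
  constructor
  · rintro rfl
    simp only [map_neg, map_smul, neg_apply, smul_apply, smul_eq_mul, hG.inner_rotation_left hy v,
      hG.rotation_rotation hy]
    constructor <;> ring
  · rintro ⟨h1, h2⟩
    rw [hG.rotation_expand hy hW A, hG.rotation_expand hy hW (frameRotation G y v),
      hG.inner_rotation_rotation hy, hG.inner_rotation_left hy,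
      show G y A W = p * κ * G y v (frameRotation G y W) by linarith,
      show G y A (frameRotation G y W) = -(p * κ * G y v W) by linarith]
    module

end IsRiemannianOn

section Oriented

variable {S : Type*} [TopologicalSpace S] [ChartedSpace Plane S] [IsManifold (𝓡 2) ∞ S]
  {h : SurfaceMetric S} {U : Set S} (o : OrientationOn h U)

/-- The rotation by a right angle, on the coordinate space of the preferred chart. -/
def rotAt (x : S) : Plane →L[ℝ] Plane := o.J x

variable {x₀ x : S}

theorem rotAt_rotAt (hx : x ∈ U) (v : Plane) : rotAt o x (rotAt o x v) = -v := o.J_J x hx v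

theorem metricAt_rotAt (hx : x ∈ U) (v w : Plane) :
    metricAt h x (rotAt o x v) (rotAt o x w) = metricAt h x v w := o.isometry x hx v w

/-- The sign relating the orientation to the orientation of the preferred chart at `x₀`. -/
def orientationSign (x₀ x : S) : ℝ :=
  chartMetric h x₀ (extChartAt (𝓡 2) x₀ x)
    (fiberCoord x₀ ⟨x, rotAt o x (frameAt x₀ x
      (frameOne (chartMetric h x₀) (extChartAt (𝓡 2) x₀ x)))⟩)
    (frameTwo (chartMetric h x₀) (extChartAt (𝓡 2) x₀ x))

/-- Carried to the coordinate plane by the chart, J becomes an orthogonal complex structure, to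
which `eq_smul_frameRotation` applies. -/
theorem orientationSign_spec (hx : x ∈ U) (hx₀ : x ∈ (chartAt Plane x₀).source) :
    orientationSign o x₀ x * orientationSign o x₀ x = 1 ∧
      ∀ w, rotAt o x (frameAt x₀ x w) = orientationSign o x₀ x • frameAt x₀ x
        (frameRotation (chartMetric h x₀) (extChartAt (𝓡 2) x₀ x) w) := by
  have hT : ∀ v : Plane, frameAt x₀ x (fiberCoord x₀ ⟨x, v⟩) = v := fun v =>
    frameAt_fiberCoord (p := ⟨x, v⟩) hx₀
  have key := (isRiemannianOn_chartMetric h x₀).eq_smul_frameRotation (extChartAt_mem_target hx₀)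
    (K := fun w => fiberCoord x₀ ⟨x, rotAt o x (frameAt x₀ x w)⟩)
    ⟨fun v w => frameAt_injective hx₀ (by simp only [hT, map_add]),
      fun c v => frameAt_injective hx₀ (by simp only [hT, map_smul])⟩
    (fun v => frameAt_injective hx₀ (by simp only [hT, map_neg, rotAt_rotAt o hx]))
    (fun v w => by
      simp only [chartMetric_apply h hx₀, hT, metricAt_rotAt o hx])
  refine ⟨key.1, fun w => ?_⟩
  have h2 := congrArg (frameAt x₀ x) (key.2 w)
  rw [hT, map_smul] at h2
  exact h2

/-- Continuity of J, applied to the first frame vector along the curve, makes the sign continuous;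
with values ±1 it is locally constant. -/
theorem eventually_orientationSign_eq (hU : IsOpen U) {Γ : ℝ → TangentBundle (𝓡 2) S} {t : ℝ}
    (hΓ : ContMDiffAt 𝓘(ℝ, ℝ) (𝓡 2).tangent ∞ Γ t) (ht : (Γ t).1 ∈ U)
    (hx₀ : (Γ t).1 ∈ (chartAt Plane x₀).source) :
    ∀ᶠ s in 𝓝 t, orientationSign o x₀ (Γ s).1 = orientationSign o x₀ (Γ t).1 := by
  have hG := isRiemannianOn_chartMetric h x₀
  have hmem := extChartAt_mem_target hx₀
  have hγ : ContinuousAt (fun s => (Γ s).1) t :=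
    (((trivializationAt Plane (TangentSpace (𝓡 2)) x₀).contMDiffAt_iff (IB := 𝓡 2)
      (by simpa using hx₀)).1 hΓ).1.continuousAt
  have hsource := eventually_mem_source hΓ hx₀
  have hc : ContinuousAt (fun s => extChartAt (𝓡 2) x₀ (Γ s).1) t :=
    (contDiffAt_baseCoord hΓ hx₀).continuousAt
  have h1 : ContinuousAt (fun s => (⟨(Γ s).1, frameAt x₀ (Γ s).1
      (frameOne (chartMetric h x₀) (extChartAt (𝓡 2) x₀ (Γ s).1))⟩ : TangentBundle (𝓡 2) S)) t := by
    have h2 : ContinuousAt (fun s => ((Γ s).1,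
        frameOne (chartMetric h x₀) (extChartAt (𝓡 2) x₀ (Γ s).1))) t :=
      hγ.prodMk (ContinuousAt.comp (g := frameOne (chartMetric h x₀))
        (hG.contDiffAt_frameOne hmem).continuousAt hc)
    have h3 := (trivializationAt Plane (TangentSpace (𝓡 2) : S → Type _)
      x₀).toOpenPartialHomeomorph.symm.continuousAt
      (x := ((Γ t).1, frameOne (chartMetric h x₀) (extChartAt (𝓡 2) x₀ (Γ t).1)))
      ((Bundle.Trivialization.mem_target _).2 (by simpa using hx₀))
    refine (ContinuousAt.comp (f := fun s => ((Γ s).1,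
        frameOne (chartMetric h x₀) (extChartAt (𝓡 2) x₀ (Γ s).1))) h3 h2).congr ?_
    filter_upwards [hsource] with s hs
    have hb : (Γ s).1 ∈ (trivializationAt Plane (TangentSpace (𝓡 2) : S → Type _) x₀).baseSet := by
      simpa using hs
    rw [Function.comp_apply, ← Bundle.Trivialization.mk_symm _ hb,
      ← Bundle.Trivialization.symmL_apply (R := ℝ) _ hb]
    have h4 := congrArg (fun L : Plane →L[ℝ] Plane => L
      (frameOne (chartMetric h x₀) (extChartAt (𝓡 2) x₀ (Γ s).1))) (symmL_eq_frameAt hs)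
    exact congrArg (fun v : Plane => (⟨(Γ s).1, v⟩ : TangentBundle (𝓡 2) S)) h4
  have hUo : IsOpen {p : TangentBundle (𝓡 2) S | p.1 ∈ U} :=
    hU.preimage (FiberBundle.continuous_proj Plane (TangentSpace (𝓡 2)))
  have h2 := ContinuousAt.comp (f := fun s => (⟨(Γ s).1, frameAt x₀ (Γ s).1
      (frameOne (chartMetric h x₀) (extChartAt (𝓡 2) x₀ (Γ s).1))⟩ : TangentBundle (𝓡 2) S))
      (x := t) (o.continuousOn.continuousAt (hUo.mem_nhds ht)) h1
  have h3 : ContinuousAt (fun s => fiberCoord x₀ ⟨(Γ s).1, rotAt o (Γ s).1 (frameAt x₀ (Γ s).1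
      (frameOne (chartMetric h x₀) (extChartAt (𝓡 2) x₀ (Γ s).1)))⟩) t := by
    have h4 := (trivializationAt Plane (TangentSpace (𝓡 2) : S → Type _)
      x₀).toOpenPartialHomeomorph.continuousAt
      (x := (⟨(Γ t).1, rotAt o (Γ t).1 (frameAt x₀ (Γ t).1
      (frameOne (chartMetric h x₀) (extChartAt (𝓡 2) x₀ (Γ t).1)))⟩ : TangentBundle (𝓡 2) S))
      (by simpa using hx₀)
    exact (ContinuousAt.comp (f := fun s => (⟨(Γ s).1, rotAt o (Γ s).1 (frameAt x₀ (Γ s).1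
      (frameOne (chartMetric h x₀) (extChartAt (𝓡 2) x₀ (Γ s).1)))⟩ : TangentBundle (𝓡 2) S))
      h4 h2).snd
  have h4 : ContinuousAt (fun s => orientationSign o x₀ (Γ s).1) t := by
    have h5 : ContinuousAt (fun s => chartMetric h x₀ (extChartAt (𝓡 2) x₀ (Γ s).1)) t :=
      ContinuousAt.comp (g := chartMetric h x₀) (hG.isMetricOn.contDiffAt hmem).continuousAt hc
    have h6 : ContinuousAt (fun s => frameTwo (chartMetric h x₀) (extChartAt (𝓡 2) x₀ (Γ s).1)) t :=
      ContinuousAt.comp (g := frameTwo (chartMetric h x₀))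
        (hG.contDiffAt_frameTwo hmem).continuousAt hc
    exact (h5.clm_apply h3).clm_apply h6
  have h5 := (orientationSign_spec o ht hx₀).1
  have h6 : ContinuousAt (fun s => orientationSign o x₀ (Γ s).1 * orientationSign o x₀ (Γ t).1) t :=
    h4.mul continuousAt_const
  -- The product of the signs at s and at t is 1 at t, so it stays positive nearby, which excludes
  -- opposite signs.
  have h7 := h6.eventually_const_lt (u := 0) (by
    change 0 < orientationSign o x₀ (Γ t).1 * orientationSign o x₀ (Γ t).1
    rw [h5]
    exact one_pos)
  filter_upwards [h7, hsource, hγ.eventually_mem (hU.mem_nhds ht)] with s hs1 hs2 hs3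
  have h8 := (orientationSign_spec o hs3 hs2).1
  rcases mul_self_eq_one_iff.1 h8 with h9 | h9 <;> rcases mul_self_eq_one_iff.1 h5 with h10 | h10 <;>
    rw [h9, h10] at hs1 ⊢ <;> norm_num at hs1

/-! #### Linear algebra in the tangent planes -/

theorem inner_rotAt_left (hx : x ∈ U) (v w : Plane) :
    metricAt h x (rotAt o x v) w = -metricAt h x v (rotAt o x w) := by
  rw [← metricAt_rotAt o hx, rotAt_rotAt o hx]
  simp

theorem inner_rotAt_self (hx : x ∈ U) (v : Plane) : metricAt h x (rotAt o x v) v = 0 := by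
  have h1 := inner_rotAt_left o hx v v
  rw [metricAt_symm h x v] at h1
  linarith

theorem inner_self_rotAt (hx : x ∈ U) (v : Plane) : metricAt h x v (rotAt o x v) = 0 := by
  rw [metricAt_symm, inner_rotAt_self o hx]

/-- J occurs twice in the second term, so the sign relating it to the chart rotation squares to 1.
-/
theorem rotAt_expand (hx : x ∈ U) {v : Plane} (hv : metricAt h x v v = 1) (w : Plane) :
    w = metricAt h x w v • v + metricAt h x w (rotAt o x v) • rotAt o x v := by
  have hG := isRiemannianOn_chartMetric h x
  have hs := mem_chart_source Plane x
  have h1 := orientationSign_spec o hx hs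
  have h2 := hG.rotation_expand (extChartAt_mem_target hs) (v := v)
    (by rw [chartMetric_self, hv]) w
  have h3 := h1.2 v
  rw [frameAt_self, frameAt_self] at h3
  rw [chartMetric_self] at h2
  rw [h3]
  conv_lhs => rw [h2]
  simp only [map_smul, smul_eq_mul, smul_smul]
  congr 2
  linear_combination (-(metricAt h x w (frameRotation (chartMetric h x) (extChartAt (𝓡 2) x x) v)))
    * h1.1

theorem metricAt_eq_of_unit (hx : x ∈ U) {v : Plane} (hv : metricAt h x v v = 1) (w : Plane) :
    metricAt h x w w = metricAt h x w v ^ 2 + metricAt h x w (rotAt o x v) ^ 2 := by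
  conv_lhs => rw [rotAt_expand o hx hv w]
  have h1 : metricAt h x (rotAt o x v) (rotAt o x v) = 1 := by rw [metricAt_rotAt o hx, hv]
  simp only [map_add, map_smul, add_apply, smul_apply, smul_eq_mul, hv, h1, inner_rotAt_self o hx,
    inner_self_rotAt o hx]
  ring

end Oriented

/-! ### Tangent vectors to the unit tangent bundle -/

section NullVectors

variable {S : Type*} [TopologicalSpace S] [ChartedSpace Plane S] [IsManifold (𝓡 2) ∞ S]
  (h : SurfaceMetric S) {U : Set S} (p : TangentBundle (𝓡 2) S)

theorem dg_apply (ξ η : Plane × Plane) : dg h p ξ η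
    = metricAt h p.1 ξ.1 η.1 - metricAt h p.1 (vertical h p ξ) (vertical h p η) := by
  rw [← chartMetric_self]
  rfl

theorem vertical_eq (ξ : Plane × Plane) : vertical h p ξ = ξ.2 + vertical h p (ξ.1, 0) := by
  simp [vertical, verticalPart]

variable {h p}

/-- The horizontal and vertical parts determine a vector, because the vertical part differs from the
second component by a term in the first one only. -/
theorem ext_vertical {ξ η : Plane × Plane} (h1 : ξ.1 = η.1)
    (h2 : vertical h p ξ = vertical h p η) : ξ = η := by
  rw [vertical_eq, vertical_eq h p η, h1] at h2
  exact Prod.ext h1 (add_right_cancel h2)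

theorem vertical_horizontalLift (u : Plane) : vertical h p (horizontalLift h p u) = 0 := by
  rw [vertical_eq, horizontalLift]
  simp

theorem vertical_verticalLift (u : Plane) : vertical h p (verticalLift p u) = u := by
  rw [vertical_eq, verticalLift]
  simp [vertical, verticalPart]

variable (o : OrientationOn h U)

theorem nullVector_fst (z : Circle) : (rotatedX o p z + fieldZ o p).1
    = (z : ℂ).re • fiberVector p + (z : ℂ).im • rotAt o p.1 (fiberVector p) := by
  simp only [rotatedX, fieldX, fieldY, fieldZ, horizontalLift, verticalLift, Prod.fst_add,
    Prod.smul_fst, add_zero]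
  rfl

theorem vertical_nullVector (z : Circle) : vertical h p (rotatedX o p z + fieldZ o p)
    = rotAt o p.1 (fiberVector p) := by
  have hX : vertical h p (fieldX (h := h) p) = 0 := vertical_horizontalLift _
  have hY : vertical h p (fieldY o p) = 0 := vertical_horizontalLift _
  have hZ : vertical h p (fieldZ o p) = rotAt o p.1 (fiberVector p) := vertical_verticalLift _
  rw [map_add, rotatedX, map_add, map_smul, map_smul, hX, hY, hZ, smul_zero, smul_zero, zero_add,
    zero_add]

theorem span_smul_nullVector {c : ℝ} (hc : c ≠ 0) (z : Circle) :
    Submodule.span ℝ {c • (rotatedX o p z + fieldZ o p)} = nullLine o p z :=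
  Submodule.span_singleton_smul_eq (IsUnit.mk0 _ hc) _

theorem circle_re_im (z : Circle) : (z : ℂ).re ^ 2 + (z : ℂ).im ^ 2 = 1 := by
  have h1 := Circle.normSq_coe z
  rw [Complex.normSq_apply] at h1
  linarith

variable (p) in
/-- The angle of the horizontal part of a null vector whose vertical component is `c`. -/
def nullAngle (ξ : Plane × Plane) (c : ℝ) : Circle :=
  Circle.exp (Complex.arg (((metricAt h p.1 ξ.1 (fiberVector p) / c : ℝ) : ℂ)
    + (metricAt h p.1 ξ.1 (rotAt o p.1 (fiberVector p)) / c : ℝ) * Complex.I))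

variable (hp : metricAt h p.1 (fiberVector p) (fiberVector p) = 1) (hpU : p.1 ∈ U)
include hp hpU

/-- The components divided by c form a complex number of modulus one, so passing to its argument
loses nothing. For negative c the angle is that of the opposite of the horizontal part. -/
theorem nullAngle_coe {ξ : Plane × Plane} {c : ℝ} (hc : c ≠ 0)
    (hξ : metricAt h p.1 ξ.1 ξ.1 = c ^ 2) :
    (nullAngle p o ξ c : ℂ) = ((metricAt h p.1 ξ.1 (fiberVector p) / c : ℝ) : ℂ)
      + (metricAt h p.1 ξ.1 (rotAt o p.1 (fiberVector p)) / c : ℝ) * Complex.I := by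
  have hz : ‖((metricAt h p.1 ξ.1 (fiberVector p) / c : ℝ) : ℂ)
      + (metricAt h p.1 ξ.1 (rotAt o p.1 (fiberVector p)) / c : ℝ) * Complex.I‖ = 1 := by
    rw [Complex.norm_add_mul_I, Real.sqrt_eq_one, div_pow, div_pow, ← add_div,
      ← metricAt_eq_of_unit o hpU hp, hξ, div_self (pow_ne_zero 2 hc)]
  have h1 := Complex.norm_mul_exp_arg_mul_I (((metricAt h p.1 ξ.1 (fiberVector p) / c : ℝ) : ℂ)
      + (metricAt h p.1 ξ.1 (rotAt o p.1 (fiberVector p)) / c : ℝ) * Complex.I)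
  rw [hz, Complex.ofReal_one, one_mul] at h1
  rw [nullAngle, Circle.coe_exp, h1]

theorem vertical_of_tangent {ξ : Plane × Plane} (hξ : ξ ∈ unitTangentSpace h p) :
    vertical h p ξ = metricAt h p.1 (vertical h p ξ) (rotAt o p.1 (fiberVector p))
      • rotAt o p.1 (fiberVector p) := by
  have h1 := rotAt_expand o hpU hp (vertical h p ξ)
  have h2 : metricAt h p.1 (vertical h p ξ) (fiberVector p) = 0 := hξ
  rwa [h2, zero_smul, zero_add] at h1

theorem inner_self_of_null {ξ : Plane × Plane} (hξ : ξ ∈ unitTangentSpace h p)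
    (h0 : dg h p ξ ξ = 0) : metricAt h p.1 ξ.1 ξ.1
      = metricAt h p.1 (vertical h p ξ) (rotAt o p.1 (fiberVector p)) ^ 2 := by
  have h2 : metricAt h p.1 (vertical h p ξ) (fiberVector p) = 0 := hξ
  rw [dg_apply, metricAt_eq_of_unit o hpU hp (vertical h p ξ), h2] at h0
  linarith

/-- Nullity makes the horizontal part as short as the vertical one, and `h` is definite. This is
what forces r ≠ 0 for a non-constant null-geodesic. -/
theorem eq_zero_of_null {ξ : Plane × Plane} (hξ : ξ ∈ unitTangentSpace h p)
    (h0 : dg h p ξ ξ = 0)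
    (hc : metricAt h p.1 (vertical h p ξ) (rotAt o p.1 (fiberVector p)) = 0) : ξ = 0 := by
  have h1 := inner_self_of_null o hp hpU hξ h0
  have h2 := vertical_of_tangent o hp hpU hξ
  rw [hc] at h1 h2
  refine ext_vertical (h := h) (p := p) ?_ ?_
  · exact eq_zero_of_metricAt_self h p.1 (by rw [h1]; norm_num)
  · rw [h2, map_zero, zero_smul]

theorem eq_smul_nullVector {ξ : Plane × Plane} {c : ℝ} (hξ : ξ ∈ unitTangentSpace h p)
    (h0 : dg h p ξ ξ = 0)
    (hc : metricAt h p.1 (vertical h p ξ) (rotAt o p.1 (fiberVector p)) = c) (hc0 : c ≠ 0) :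
    ξ = c • (rotatedX o p (nullAngle p o ξ c) + fieldZ o p) := by
  have h1 := inner_self_of_null o hp hpU hξ h0
  have h2 := vertical_of_tangent o hp hpU hξ
  rw [hc] at h1 h2
  refine ext_vertical (h := h) (p := p) ?_ ?_
  · have h3 := nullAngle_coe o hp hpU hc0 h1
    rw [Prod.smul_fst, nullVector_fst, h3]
    conv_lhs => rw [rotAt_expand o hpU hp ξ.1]
    simp only [Complex.add_re, Complex.add_im, Complex.ofReal_re, Complex.ofReal_im,
      Complex.mul_re, Complex.mul_im, Complex.I_re, Complex.I_im, mul_zero, mul_one, sub_zero,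
      add_zero, zero_add, smul_add, smul_smul, mul_div_cancel₀ _ hc0]
  · rw [map_smul, vertical_nullVector, h2]

theorem dg_nullVector (z : Circle) :
    dg h p (rotatedX o p z + fieldZ o p) (rotatedX o p z + fieldZ o p) = 0 := by
  rw [dg_apply, vertical_nullVector, nullVector_fst, metricAt_rotAt o hpU, hp]
  simp only [map_add, map_smul, add_apply, smul_apply, smul_eq_mul, hp, inner_rotAt_self o hpU,
    inner_self_rotAt o hpU, metricAt_rotAt o hpU]
  linear_combination circle_re_im z

theorem bijOn_nullLine : Set.BijOn (nullLine o p) Set.univ (nullCircle h p) := by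
  have hJ : metricAt h p.1 (rotAt o p.1 (fiberVector p)) (rotAt o p.1 (fiberVector p)) = 1 := by
    rw [metricAt_rotAt o hpU, hp]
  have hJ0 : rotAt o p.1 (fiberVector p) ≠ 0 := fun h0 => by simp [h0] at hJ
  have hne : ∀ z, rotatedX o p z + fieldZ o p ≠ 0 := fun z h0 => by
    have h1 := vertical_nullVector o (p := p) z
    rw [h0, map_zero] at h1
    exact hJ0 h1.symm
  refine ⟨fun z _ => ⟨_, ?_, hne z, dg_nullVector o hp hpU z, rfl⟩, ?_, ?_⟩
  · change metricAt h p.1 (vertical h p (rotatedX o p z + fieldZ o p)) (fiberVector p) = 0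
    rw [vertical_nullVector, inner_rotAt_self o hpU]
  · intro z _ z' _ hzz
    have h1 : rotatedX o p z + fieldZ o p ∈ nullLine o p z' := by
      rw [← hzz]
      exact Submodule.mem_span_singleton_self _
    obtain ⟨a, ha⟩ := Submodule.mem_span_singleton.1 h1
    have h2 := congrArg (vertical h p) ha
    rw [map_smul, vertical_nullVector, vertical_nullVector] at h2
    -- Both generators have vertical part Jv, which fixes the scale on the line; the horizontal
    -- parts then give cos θ and sin θ.
    have h3 : a = 1 := by
      have h4 := congrArg (fun v => metricAt h p.1 v (rotAt o p.1 (fiberVector p))) h2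
      simpa [hJ] using h4
    rw [h3, one_smul] at ha
    have h5 := congrArg Prod.fst ha
    rw [nullVector_fst, nullVector_fst] at h5
    have h6 := congrArg (fun v => metricAt h p.1 v (fiberVector p)) h5
    have h7 := congrArg (fun v => metricAt h p.1 v (rotAt o p.1 (fiberVector p))) h5
    simp [hp, inner_rotAt_self o hpU] at h6
    simp [hJ, inner_self_rotAt o hpU] at h7
    exact Circle.ext (Complex.ext h6.symm h7.symm)
  · rintro ℓ ⟨ξ, hξ, hξ0, h0, rfl⟩
    have hc : metricAt h p.1 (vertical h p ξ) (rotAt o p.1 (fiberVector p)) ≠ 0 := fun hc =>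
      hξ0 (eq_zero_of_null o hp hpU hξ h0 hc)
    refine ⟨nullAngle p o ξ (metricAt h p.1 (vertical h p ξ) (rotAt o p.1 (fiberVector p))),
      Set.mem_univ _, ?_⟩
    conv_rhs => rw [eq_smul_nullVector o hp hpU hξ h0 rfl hc]
    rw [span_smul_nullVector o hc]

end NullVectors

/-! ### Curves in the unit tangent bundle -/

section Curves

variable {S : Type*} [TopologicalSpace S] [ChartedSpace Plane S] [IsManifold (𝓡 2) ∞ S]
  {h : SurfaceMetric S} {U : Set S} {Γ : ℝ → TangentBundle (𝓡 2) S} {t : ℝ} {α : ℝ → ℝ}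

/-- `α` is the angle of the curve `Γ` of unit vectors in the preferred chart at `(Γ t).1`, for times
near `t`. -/
def IsAngleAt (h : SurfaceMetric S) (Γ : ℝ → TangentBundle (𝓡 2) S) (t : ℝ) (α : ℝ → ℝ) : Prop :=
  ContDiffAt ℝ ∞ α t ∧ ∀ᶠ s in 𝓝 t, fiberCoord (Γ t).1 (Γ s)
    = unitVector (chartMetric h (Γ t).1) (baseCoord (Γ t).1 (Γ s), α s)

/-- The angular velocity of a curve in the unit tangent bundle, in the chart at `(Γ t).1`. -/
abbrev chartAngularVelocity (h : SurfaceMetric S) (Γ : ℝ → TangentBundle (𝓡 2) S) (t : ℝ)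
    (α : ℝ → ℝ) : ℝ → ℝ :=
  angularVelocity (chartMetric h (Γ t).1) (fun s => baseCoord (Γ t).1 (Γ s)) α

theorem eq_unitParam_iff {x₀ : S} {p : TangentBundle (𝓡 2) S}
    (hp : p.1 ∈ (chartAt Plane x₀).source) (a : ℝ) :
    p = unitParam h x₀ (extChartAt (𝓡 2) x₀ p.1, a) ↔
      fiberCoord x₀ p = unitVector (chartMetric h x₀) (baseCoord x₀ p, a) := by
  have hx' : (extChartAt (𝓡 2) x₀).symm (extChartAt (𝓡 2) x₀ p.1) = p.1 :=
    (extChartAt (𝓡 2) x₀).left_inv (by simpa using hp)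
  have h1 : ∀ (x' : S) (w : Plane), x' = p.1 →
      (⟨x', (trivializationAt Plane (TangentSpace (𝓡 2)) x₀).symmL ℝ x' w⟩ : TangentBundle (𝓡 2) S)
        = ⟨p.1, frameAt x₀ p.1 w⟩ := by
    rintro x' w rfl
    exact congrArg (fun v : Plane => (⟨p.1, v⟩ : TangentBundle (𝓡 2) S))
      (congrArg (fun L : Plane →L[ℝ] Plane => L w) (symmL_eq_frameAt hp))
  have h2 : unitParam h x₀ (extChartAt (𝓡 2) x₀ p.1, a)
      = ⟨p.1, frameAt x₀ p.1 (unitVector (chartMetric h x₀) (baseCoord x₀ p, a))⟩ := h1 _ _ hx'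
  rw [h2]
  constructor
  · intro h3
    conv_lhs => rw [h3]
    exact fiberCoord_frameAt hp _
  · intro h3
    rw [← h3, frameAt_fiberCoord hp]
    rfl

/-- In chart coordinates the geodesic equation becomes conservation of angular velocity together
with the magnetic equation of the base curve. -/
theorem geodesicEquationAt_iff (hΓ : ContMDiffAt 𝓘(ℝ, ℝ) (𝓡 2).tangent ∞ Γ t) :
    GeodesicEquationAt h Γ t ↔ ∃ α : ℝ → ℝ, IsAngleAt h Γ t α ∧
      deriv (chartAngularVelocity h Γ t α) t = 0 ∧
      acceleration (chartMetric h (Γ t).1) (fun s => baseCoord (Γ t).1 (Γ s)) t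
        = -((gaussCurvature h (Γ t).1 * chartAngularVelocity h Γ t α t) •
          frameRotation (chartMetric h (Γ t).1) (baseCoord (Γ t).1 (Γ t))
            (deriv (fun s => baseCoord (Γ t).1 (Γ s)) t)) := by
  have hs := mem_chart_source Plane (Γ t).1
  have hc := (contDiffAt_baseCoord hΓ hs).of_le two_le_infty
  refine exists_congr fun α => ?_
  rw [IsAngleAt, and_assoc]
  refine and_congr_right fun hα => and_congr ?_ ?_
  · constructor
    · intro h1
      filter_upwards [h1, eventually_mem_source hΓ hs] with s hs1 hs2
      exact (eq_unitParam_iff hs2 _).1 hs1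
    · intro h1
      filter_upwards [h1, eventually_mem_source hΓ hs] with s hs1 hs2
      exact (eq_unitParam_iff hs2 _).2 hs1
  · exact (isRiemannianOn_chartMetric h (Γ t).1).acceleration_magneticMetric_eq_zero_iff
      (extChartAt_mem_target hs) hc (hα.of_le two_le_infty)

theorem exists_isAngleAt (hΓ : ContMDiffAt 𝓘(ℝ, ℝ) (𝓡 2).tangent ∞ Γ t)
    (hunit : ∀ᶠ s in 𝓝 t, Γ s ∈ unitTangent h) : ∃ α, IsAngleAt h Γ t α := by
  have hs := mem_chart_source Plane (Γ t).1
  refine (isRiemannianOn_chartMetric h (Γ t).1).exists_angle (extChartAt_mem_target hs)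
    (contDiffAt_baseCoord hΓ hs) (contDiffAt_fiberCoord hΓ hs) ?_
  filter_upwards [hunit, eventually_mem_source hΓ hs] with s hs1 hs2
  rw [baseCoord, chartMetric_apply h hs2, frameAt_fiberCoord hs2]
  exact hs1

/-- The velocity of a curve in the unit tangent bundle, in coordinates. -/
theorem IsAngleAt.eventually_velocity (hα : IsAngleAt h Γ t α)
    (hΓ : ∀ᶠ s in 𝓝 t, ContMDiffAt 𝓘(ℝ, ℝ) (𝓡 2).tangent ∞ Γ s) :
    ∀ᶠ s in 𝓝 t, (Γ s).1 ∈ (chartAt Plane (Γ t).1).source ∧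
      fiberVector (Γ s) = frameAt (Γ t).1 (Γ s).1
        (unitVector (chartMetric h (Γ t).1) (baseCoord (Γ t).1 (Γ s), α s)) ∧
      (liftVelocity Γ s).1 = frameAt (Γ t).1 (Γ s).1
        (deriv (fun s => baseCoord (Γ t).1 (Γ s)) s) ∧
      vertical h (Γ s) (liftVelocity Γ s) = chartAngularVelocity h Γ t α s •
        frameAt (Γ t).1 (Γ s).1 (frameRotation (chartMetric h (Γ t).1) (baseCoord (Γ t).1 (Γ s))
          (unitVector (chartMetric h (Γ t).1) (baseCoord (Γ t).1 (Γ s), α s))) := by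
  have hs0 := mem_chart_source Plane (Γ t).1
  -- The derivative at s of the fibre coordinates needs the angle formula on a neighbourhood of s,
  -- not only at s.
  filter_upwards [hα.2, hα.2.eventually_nhds, hΓ, eventually_mem_source hΓ.self_of_nhds hs0,
    (hα.1.of_le two_le_infty).eventually (by simp)] with s h1 h2 h3 h4 h5
  refine ⟨h4, ?_, liftVelocity_fst h3 h4, ?_⟩
  · rw [← h1, frameAt_fiberCoord h4]
  · have h6 : covDeriv (chartMetric h (Γ t).1) (fun σ => baseCoord (Γ t).1 (Γ σ))
        (fun σ => fiberCoord (Γ t).1 (Γ σ)) s = covDeriv (chartMetric h (Γ t).1)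
        (fun σ => baseCoord (Γ t).1 (Γ σ))
        (fun σ => unitVector (chartMetric h (Γ t).1) (baseCoord (Γ t).1 (Γ σ), α σ)) s := by
      have h7 : (fun σ => fiberCoord (Γ t).1 (Γ σ)) =ᶠ[𝓝 s] fun σ =>
        unitVector (chartMetric h (Γ t).1) (baseCoord (Γ t).1 (Γ σ), α σ) := h2
      rw [covDeriv, covDeriv, h7.deriv_eq, h1]
    rw [vertical_liftVelocity h h3 h4, h6, (isRiemannianOn_chartMetric h (Γ t).1).covDeriv_unitVector
      (extChartAt_mem_target h4) ((contDiffAt_baseCoord h3 h4).differentiableAt (by simp))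
      (h5.differentiableAt (by simp)), map_smul]

theorem IsAngleAt.differentiableAt_angularVelocity (hα : IsAngleAt h Γ t α)
    (hΓ : ContMDiffAt 𝓘(ℝ, ℝ) (𝓡 2).tangent ∞ Γ t) :
    DifferentiableAt ℝ (chartAngularVelocity h Γ t α) t :=
  ((isRiemannianOn_chartMetric h (Γ t).1).differentiableAt_angularVelocity
    (extChartAt_mem_target (mem_chart_source Plane (Γ t).1))
    ((contDiffAt_baseCoord hΓ (mem_chart_source Plane (Γ t).1)).of_le two_le_infty)
    (hα.1.of_le two_le_infty)).differentiableAt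

/-- The squared norm of the vertical part of the velocity. -/
theorem IsAngleAt.eventually_norm_vertical (hα : IsAngleAt h Γ t α)
    (hΓ : ∀ᶠ s in 𝓝 t, ContMDiffAt 𝓘(ℝ, ℝ) (𝓡 2).tangent ∞ Γ s) :
    ∀ᶠ s in 𝓝 t, metricAt h (Γ s).1 (vertical h (Γ s) (liftVelocity Γ s))
      (vertical h (Γ s) (liftVelocity Γ s)) = chartAngularVelocity h Γ t α s ^ 2 := by
  filter_upwards [hα.eventually_velocity hΓ] with s ⟨h1, _, _, h4⟩
  have hG := isRiemannianOn_chartMetric h (Γ t).1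
  have hmem := extChartAt_mem_target h1
  rw [h4]
  simp only [map_smul, smul_apply, smul_eq_mul]
  rw [← chartMetric_apply h h1, baseCoord, hG.inner_rotation_rotation hmem,
    hG.inner_unitVector_self hmem]
  ring

theorem liftVelocity_mem_unitTangentSpace
    (hΓ : ∀ᶠ s in 𝓝 t, ContMDiffAt 𝓘(ℝ, ℝ) (𝓡 2).tangent ∞ Γ s)
    (hunit : ∀ᶠ s in 𝓝 t, Γ s ∈ unitTangent h) :
    liftVelocity Γ t ∈ unitTangentSpace h (Γ t) := by
  obtain ⟨α, hα⟩ := exists_isAngleAt hΓ.self_of_nhds hunit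
  obtain ⟨h1, h2, -, h4⟩ := (hα.eventually_velocity hΓ).self_of_nhds
  change metricAt h (Γ t).1 (vertical h (Γ t) (liftVelocity Γ t)) (fiberVector (Γ t)) = 0
  rw [h2, h4, map_smul, smul_apply, ← chartMetric_apply h h1, baseCoord,
    (isRiemannianOn_chartMetric h (Γ t).1).inner_rotation_self (extChartAt_mem_target h1), smul_zero]

/-! ### Components of the velocity in the moving frame (v, Jv) -/

section Oriented

variable (o : OrientationOn h U)

/-- The components of the velocity of a curve in the unit tangent bundle, in coordinates. -/
theorem IsAngleAt.eventually_components (hU : IsOpen U) (hα : IsAngleAt h Γ t α)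
    (hΓ : ∀ᶠ s in 𝓝 t, ContMDiffAt 𝓘(ℝ, ℝ) (𝓡 2).tangent ∞ Γ s)
    (hΓU : ∀ᶠ s in 𝓝 t, (Γ s).1 ∈ U) :
    ∀ᶠ s in 𝓝 t,
      metricAt h (Γ s).1 (vertical h (Γ s) (liftVelocity Γ s))
        (rotAt o (Γ s).1 (fiberVector (Γ s)))
        = orientationSign o (Γ t).1 (Γ t).1 * chartAngularVelocity h Γ t α s ∧
      metricAt h (Γ s).1 (liftVelocity Γ s).1 (fiberVector (Γ s))
        = chartMetric h (Γ t).1 (baseCoord (Γ t).1 (Γ s))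
          (deriv (fun s => baseCoord (Γ t).1 (Γ s)) s)
          (unitVector (chartMetric h (Γ t).1) (baseCoord (Γ t).1 (Γ s), α s)) ∧
      metricAt h (Γ s).1 (liftVelocity Γ s).1 (rotAt o (Γ s).1 (fiberVector (Γ s)))
        = orientationSign o (Γ t).1 (Γ t).1 * chartMetric h (Γ t).1 (baseCoord (Γ t).1 (Γ s))
          (deriv (fun s => baseCoord (Γ t).1 (Γ s)) s)
          (frameRotation (chartMetric h (Γ t).1) (baseCoord (Γ t).1 (Γ s))
            (unitVector (chartMetric h (Γ t).1) (baseCoord (Γ t).1 (Γ s), α s))) := by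
  have hs0 := mem_chart_source Plane (Γ t).1
  filter_upwards [hα.eventually_velocity hΓ, hΓU,
    eventually_orientationSign_eq o hU hΓ.self_of_nhds hΓU.self_of_nhds hs0]
    with s ⟨h1, h2, h3, h4⟩ h5 h6
  have hG := isRiemannianOn_chartMetric h (Γ t).1
  have hmem := extChartAt_mem_target h1
  have h7 := (orientationSign_spec o h5 h1).2
    (unitVector (chartMetric h (Γ t).1) (baseCoord (Γ t).1 (Γ s), α s))
  rw [← h2, h6, ← baseCoord] at h7
  refine ⟨?_, ?_, ?_⟩
  · rw [h7, h4]
    simp only [map_smul, smul_apply, smul_eq_mul]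
    rw [← chartMetric_apply h h1, baseCoord, hG.inner_rotation_rotation hmem,
      hG.inner_unitVector_self hmem]
    ring
  · rw [h2, h3, ← chartMetric_apply h h1, baseCoord]
  · rw [h7, h3, map_smul, ← chartMetric_apply h h1, smul_eq_mul, baseCoord]

variable {o}

/-- The magnetic equation in terms of the components of the velocity: the equation of motion of
the projection holds if and only if the components of its velocity in the moving frame `(v, Jv)`
rotate with angular velocity `-(1 + κ) r`. -/
theorem IsAngleAt.acceleration_eq_iff (hU : IsOpen U) (hα : IsAngleAt h Γ t α)
    (hΓ : ∀ᶠ s in 𝓝 t, ContMDiffAt 𝓘(ℝ, ℝ) (𝓡 2).tangent ∞ Γ s)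
    (hΓU : ∀ᶠ s in 𝓝 t, (Γ s).1 ∈ U) {r : ℝ}
    (hr : metricAt h (Γ t).1 (vertical h (Γ t) (liftVelocity Γ t))
      (rotAt o (Γ t).1 (fiberVector (Γ t))) = r) :
    acceleration (chartMetric h (Γ t).1) (fun s => baseCoord (Γ t).1 (Γ s)) t
        = -((gaussCurvature h (Γ t).1 * chartAngularVelocity h Γ t α t) •
          frameRotation (chartMetric h (Γ t).1) (baseCoord (Γ t).1 (Γ t))
            (deriv (fun s => baseCoord (Γ t).1 (Γ s)) t)) ↔
      HasDerivAt (fun s => metricAt h (Γ s).1 (liftVelocity Γ s).1 (fiberVector (Γ s)))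
        (r * (1 + gaussCurvature h (Γ t).1) * metricAt h (Γ t).1 (liftVelocity Γ t).1
          (rotAt o (Γ t).1 (fiberVector (Γ t)))) t ∧
      HasDerivAt (fun s => metricAt h (Γ s).1 (liftVelocity Γ s).1
        (rotAt o (Γ s).1 (fiberVector (Γ s))))
        (-(r * (1 + gaussCurvature h (Γ t).1) * metricAt h (Γ t).1 (liftVelocity Γ t).1
          (fiberVector (Γ t)))) t := by
  have hs0 := mem_chart_source Plane (Γ t).1
  have hcomp := hα.eventually_components o hU hΓ hΓU
  obtain ⟨c1, c2, c3⟩ := hcomp.self_of_nhds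
  have hε := (orientationSign_spec o hΓU.self_of_nhds hs0).1
  have hG := isRiemannianOn_chartMetric h (Γ t).1
  have hmem : baseCoord (Γ t).1 (Γ t) ∈ (extChartAt (𝓡 2) (Γ t).1).target :=
    extChartAt_mem_target hs0
  have hc := (contDiffAt_baseCoord hΓ.self_of_nhds hs0).of_le two_le_infty
  have hd1 := hG.hasDerivAt_inner_unitVector hmem hc (hα.1.differentiableAt (by simp))
  have hd2 := (hG.hasDerivAt_inner_rotation_unitVector hmem hc
    (hα.1.differentiableAt (by simp))).const_mul (orientationSign o (Γ t).1 (Γ t).1)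
  have he1 := hd1.congr_of_eventuallyEq (hcomp.mono fun s hs => hs.2.1)
  have he2 := hd2.congr_of_eventuallyEq (hcomp.mono fun s hs => hs.2.2)
  rw [c2, c3, ← hr, c1]
  have hiff := hG.eq_smul_rotation_iff hmem (hG.inner_unitVector_self hmem (α t))
    (acceleration (chartMetric h (Γ t).1) (fun s => baseCoord (Γ t).1 (Γ s)) t)
    (deriv (fun s => baseCoord (Γ t).1 (Γ s)) t) (gaussCurvature h (Γ t).1)
    (chartAngularVelocity h Γ t α t)
  refine hiff.trans (and_congr ⟨fun h1 => he1.congr_deriv ?_, fun h1 => ?_⟩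
    ⟨fun h1 => he2.congr_deriv ?_, fun h1 => ?_⟩)
  · refine Eq.trans h1 ?_
    linear_combination (-(chartAngularVelocity h Γ t α t * (1 + gaussCurvature h (Γ t).1)
      * chartMetric h (Γ t).1 (baseCoord (Γ t).1 (Γ t))
        (deriv (fun s => baseCoord (Γ t).1 (Γ s)) t)
        (frameRotation (chartMetric h (Γ t).1) (baseCoord (Γ t).1 (Γ t))
          (unitVector (chartMetric h (Γ t).1) (baseCoord (Γ t).1 (Γ t), α t))))) * hε
  · refine Eq.trans (he1.unique h1) ?_
    linear_combination (chartAngularVelocity h Γ t α t * (1 + gaussCurvature h (Γ t).1)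
      * chartMetric h (Γ t).1 (baseCoord (Γ t).1 (Γ t))
        (deriv (fun s => baseCoord (Γ t).1 (Γ s)) t)
        (frameRotation (chartMetric h (Γ t).1) (baseCoord (Γ t).1 (Γ t))
          (unitVector (chartMetric h (Γ t).1) (baseCoord (Γ t).1 (Γ t), α t)))) * hε
  · refine Eq.trans (congrArg _ h1) ?_
    ring
  · have h2 := he2.unique h1
    have h3 : orientationSign o (Γ t).1 (Γ t).1 ≠ 0 := fun h0 => by simp [h0] at hε
    refine mul_left_cancel₀ h3 (Eq.trans h2 ?_)
    ring

end Oriented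

end Curves

/-! ### Null-geodesics -/

section NullGeodesics

variable {S : Type*} [TopologicalSpace S] [ChartedSpace Plane S] [IsManifold (𝓡 2) ∞ S]
  {h : SurfaceMetric S} {U : Set S} {Γ : ℝ → TangentBundle (𝓡 2) S} {t : ℝ}

theorem IsSmoothCurve.eventually {I : Set ℝ} (hΓ : IsSmoothCurve h U Γ I) (hI : IsOpen I)
    (ht : t ∈ I) : (∀ᶠ s in 𝓝 t, ContMDiffAt 𝓘(ℝ, ℝ) (𝓡 2).tangent ∞ Γ s) ∧
      (∀ᶠ s in 𝓝 t, Γ s ∈ unitTangent h) ∧ ∀ᶠ s in 𝓝 t, (Γ s).1 ∈ U := by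
  have hmem := hI.eventually_mem ht
  exact ⟨hmem.mono fun s hs => (hΓ.1 s hs).contMDiffAt (hI.mem_nhds hs),
    hmem.mono fun s hs => (hΓ.2 s hs).1, hmem.mono fun s hs => (hΓ.2 s hs).2⟩

theorem speed_eq (hΓ : ContMDiffAt 𝓘(ℝ, ℝ) (𝓡 2).tangent ∞ Γ t) :
    speed h (fun s => (Γ s).1) t
      = √(metricAt h (Γ t).1 (liftVelocity Γ t).1 (liftVelocity Γ t).1) := by
  rw [← velocity_eq_liftVelocity hΓ]
  rfl

/-- The quantity is p², for which the sign of the angular velocity, and hence an orientation, is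
irrelevant. -/
theorem GeodesicEquationAt.hasDerivAt_norm_vertical (hgeo : GeodesicEquationAt h Γ t)
    (hΓ : ∀ᶠ s in 𝓝 t, ContMDiffAt 𝓘(ℝ, ℝ) (𝓡 2).tangent ∞ Γ s) :
    HasDerivAt (fun s => metricAt h (Γ s).1 (vertical h (Γ s) (liftVelocity Γ s))
      (vertical h (Γ s) (liftVelocity Γ s))) 0 t := by
  obtain ⟨α, hα, hp, -⟩ := (geodesicEquationAt_iff hΓ.self_of_nhds).1 hgeo
  have h1 := (hα.differentiableAt_angularVelocity hΓ.self_of_nhds).hasDerivAt.pow 2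
  rw [hp, mul_zero] at h1
  exact h1.congr_of_eventuallyEq (hα.eventually_norm_vertical hΓ)

variable (o : OrientationOn h U)

theorem GeodesicEquationAt.hasDerivAt_vertical (hgeo : GeodesicEquationAt h Γ t) (hU : IsOpen U)
    (hΓ : ∀ᶠ s in 𝓝 t, ContMDiffAt 𝓘(ℝ, ℝ) (𝓡 2).tangent ∞ Γ s)
    (hΓU : ∀ᶠ s in 𝓝 t, (Γ s).1 ∈ U) :
    HasDerivAt (fun s => metricAt h (Γ s).1 (vertical h (Γ s) (liftVelocity Γ s))
      (rotAt o (Γ s).1 (fiberVector (Γ s)))) 0 t := by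
  obtain ⟨α, hα, hp, -⟩ := (geodesicEquationAt_iff hΓ.self_of_nhds).1 hgeo
  have h1 := (hα.differentiableAt_angularVelocity hΓ.self_of_nhds).hasDerivAt.const_mul
    (orientationSign o (Γ t).1 (Γ t).1)
  rw [hp, mul_zero] at h1
  exact h1.congr_of_eventuallyEq ((hα.eventually_components o hU hΓ hΓU).mono fun s hs => hs.1)

/-- The acceleration is -κ p times the chart rotation of the velocity, and J is ε times this
rotation. Their pairing is -κ ε p r² = -κ r³, to be divided by |r|³. -/
theorem GeodesicEquationAt.geodesicCurvature_eq (hgeo : GeodesicEquationAt h Γ t) (hU : IsOpen U)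
    (hΓ : ∀ᶠ s in 𝓝 t, ContMDiffAt 𝓘(ℝ, ℝ) (𝓡 2).tangent ∞ Γ s)
    (hΓU : ∀ᶠ s in 𝓝 t, (Γ s).1 ∈ U) {r : ℝ} (hr0 : r ≠ 0)
    (hr : metricAt h (Γ t).1 (vertical h (Γ t) (liftVelocity Γ t))
      (rotAt o (Γ t).1 (fiberVector (Γ t))) = r)
    (hspeed : metricAt h (Γ t).1 (liftVelocity Γ t).1 (liftVelocity Γ t).1 = r ^ 2) :
    geodesicCurvature h o (fun s => (Γ s).1) t = -(gaussCurvature h (Γ t).1 * (r / |r|)) := by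
  obtain ⟨α, hα, -, hacc⟩ := (geodesicEquationAt_iff hΓ.self_of_nhds).1 hgeo
  have hs := mem_chart_source Plane (Γ t).1
  have hG := isRiemannianOn_chartMetric h (Γ t).1
  have hp := ((hα.eventually_components o hU hΓ hΓU).self_of_nhds).1
  rw [hr] at hp
  have hJ := (orientationSign_spec o hΓU.self_of_nhds hs).2 (liftVelocity Γ t).1
  rw [frameAt_self, frameAt_self] at hJ
  have hvel : (liftVelocity Γ t).1 = deriv (fun s => baseCoord (Γ t).1 (Γ s)) t :=
    congrArg Prod.fst (liftVelocity_eq hΓ.self_of_nhds)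
  have hnum : metricAt h (Γ t).1 (acceleration (chartMetric h (Γ t).1)
      (fun s => baseCoord (Γ t).1 (Γ s)) t) (rotAt o (Γ t).1 (liftVelocity Γ t).1)
      = -(gaussCurvature h (Γ t).1 * r * r ^ 2) := by
    have h1 := hG.inner_rotation_rotation (extChartAt_mem_target hs) (liftVelocity Γ t).1
      (liftVelocity Γ t).1
    rw [chartMetric_self, hspeed] at h1
    rw [hacc, hJ, ← hvel]
    simp only [map_neg, map_smul, neg_apply, smul_apply, smul_eq_mul]
    have h2 : metricAt h (Γ t).1 (frameRotation (chartMetric h (Γ t).1)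
      (baseCoord (Γ t).1 (Γ t)) (liftVelocity Γ t).1) (frameRotation (chartMetric h (Γ t).1)
      (extChartAt (𝓡 2) (Γ t).1 (Γ t).1) (liftVelocity Γ t).1) = r ^ 2 := h1
    rw [h2]
    linear_combination (gaussCurvature h (Γ t).1 * r ^ 2) * hp
  have hdef : geodesicCurvature h o (fun s => (Γ s).1) t
      = metricAt h (Γ t).1 (acceleration (chartMetric h (Γ t).1)
      (fun s => baseCoord (Γ t).1 (Γ s)) t) (rotAt o (Γ t).1 (liftVelocity Γ t).1)
        / speed h (fun s => (Γ s).1) t ^ 3 := by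
    rw [← velocity_eq_liftVelocity hΓ.self_of_nhds]
    rfl
  rw [hdef, hnum, speed_eq hΓ.self_of_nhds, hspeed, Real.sqrt_sq_eq_abs, ← sq_abs r]
  have h3 : |r| ≠ 0 := abs_ne_zero.2 hr0
  field_simp

/-- A null-geodesic projects to a curve of constant speed. -/
theorem IsNullGeodesic.exists_speed_eq {I : Set ℝ} (hΓ : IsNullGeodesic h U Γ I) (hI : IsOpen I)
    (hI' : IsPreconnected I) : ∃ c : ℝ, ∀ t ∈ I, speed h (fun s => (Γ s).1) t = c := by
  have hd : ∀ t ∈ I, HasDerivAt (fun s => metricAt h (Γ s).1 (vertical h (Γ s) (liftVelocity Γ s))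
      (vertical h (Γ s) (liftVelocity Γ s))) 0 t := fun t ht =>
    (hΓ.2.1 t ht).hasDerivAt_norm_vertical (hΓ.1.eventually hI ht).1
  obtain ⟨c, hc⟩ := hI.exists_is_const_of_deriv_eq_zero hI'
    (fun t ht => (hd t ht).differentiableAt.differentiableWithinAt) fun t ht => (hd t ht).deriv
  refine ⟨√c, fun t ht => ?_⟩
  have h1 := hΓ.2.2 t ht
  rw [dg_apply] at h1
  rw [speed_eq (hΓ.1.eventually hI ht).1.self_of_nhds, ← hc t ht, sub_eq_zero.1 h1]

theorem IsNullGeodesic.exists_vertical_eq {I : Set ℝ} (hΓ : IsNullGeodesic h U Γ I) (hU : IsOpen U)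
    (hI : IsOpen I) (hI' : IsPreconnected I) : ∃ r : ℝ, ∀ t ∈ I,
      metricAt h (Γ t).1 (vertical h (Γ t) (liftVelocity Γ t))
        (rotAt o (Γ t).1 (fiberVector (Γ t))) = r := by
  have hd : ∀ t ∈ I, HasDerivAt (fun s => metricAt h (Γ s).1
      (vertical h (Γ s) (liftVelocity Γ s)) (rotAt o (Γ s).1 (fiberVector (Γ s)))) 0 t :=
    fun t ht => (hΓ.2.1 t ht).hasDerivAt_vertical o hU (hΓ.1.eventually hI ht).1
      (hΓ.1.eventually hI ht).2.2
  exact hI.exists_is_const_of_deriv_eq_zero hI'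
    (fun t ht => (hd t ht).differentiableAt.differentiableWithinAt) fun t ht => (hd t ht).deriv

theorem smul_fieldW_fst (r : ℝ) (p : TangentBundle (𝓡 2) S) (z : Circle) :
    (r • fieldW o p z).1 = r • (rotatedX o p z + fieldZ o p) := by
  simp [fieldW, fieldXt, fieldZt, fieldTheta]

/-- Multiplication of -r(1 + κ)i by z, split into real and imaginary parts to match the two
derivatives in `IsAngleAt.acceleration_eq_iff`. -/
theorem smul_fieldW_snd (r : ℝ) (p : TangentBundle (𝓡 2) S) (z : Circle) :
    (r • fieldW o p z).2 = ((r * (1 + gaussCurvature h p.1) * (z : ℂ).im : ℝ) : ℂ)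
      + (-(r * (1 + gaussCurvature h p.1) * (z : ℂ).re) : ℝ) * Complex.I := by
  apply Complex.ext <;> simp [fieldW, fieldXt, fieldZt, fieldTheta] <;> ring

/-- The components of the projected velocity in (v, Jv), divided by the constant r, are the real and
imaginary parts of z, so the magnetic equation is the equation for z. -/
theorem IsNullGeodesic.isIntegralCurveW {I : Set ℝ} (hΓ : IsNullGeodesic h U Γ I) (hU : IsOpen U)
    (hI : IsOpen I) {r : ℝ} (hr0 : r ≠ 0)
    (hr : ∀ t ∈ I, metricAt h (Γ t).1 (vertical h (Γ t) (liftVelocity Γ t))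
        (rotAt o (Γ t).1 (fiberVector (Γ t))) = r) :
    IsIntegralCurveW o r Γ (fun t => nullAngle (Γ t) o (liftVelocity Γ t) r) I := by
  have hT : ∀ t ∈ I, liftVelocity Γ t ∈ unitTangentSpace h (Γ t) := fun t ht =>
    liftVelocity_mem_unitTangentSpace (hΓ.1.eventually hI ht).1 (hΓ.1.eventually hI ht).2.1
  have hz : ∀ t ∈ I, (nullAngle (Γ t) o (liftVelocity Γ t) r : ℂ)
      = ((metricAt h (Γ t).1 (liftVelocity Γ t).1 (fiberVector (Γ t)) / r : ℝ) : ℂ)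
      + (metricAt h (Γ t).1 (liftVelocity Γ t).1
        (rotAt o (Γ t).1 (fiberVector (Γ t))) / r : ℝ) * Complex.I := fun t ht => by
    refine nullAngle_coe o (hΓ.1.2 t ht).1 (hΓ.1.2 t ht).2 hr0 ?_
    rw [inner_self_of_null o (hΓ.1.2 t ht).1 (hΓ.1.2 t ht).2 (hT t ht) (hΓ.2.2 t ht), hr t ht]
  refine ⟨hΓ.1, fun t ht => ⟨?_, ?_⟩⟩
  · rw [smul_fieldW_fst]
    exact eq_smul_nullVector o (hΓ.1.2 t ht).1 (hΓ.1.2 t ht).2 (hT t ht) (hΓ.2.2 t ht) (hr t ht)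
      hr0
  · obtain ⟨h1, -, h3⟩ := hΓ.1.eventually hI ht
    obtain ⟨α, hα, -, hacc⟩ := (geodesicEquationAt_iff h1.self_of_nhds).1 (hΓ.2.1 t ht)
    obtain ⟨ha, hb⟩ := (hα.acceleration_eq_iff hU h1 h3 (hr t ht)).1 hacc
    have h4 := (ha.div_const r).ofReal_comp.add ((hb.div_const r).ofReal_comp.mul_const Complex.I)
    refine (h4.congr_of_eventuallyEq ((hI.eventually_mem ht).mono hz)).congr_deriv ?_
    rw [smul_fieldW_snd, hz t ht]
    apply Complex.ext <;> simp <;> ring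

theorem IsIntegralCurveW.isNullGeodesic {I : Set ℝ} {r : ℝ} {z : ℝ → Circle}
    (hΓ : IsIntegralCurveW o r Γ z I) (hU : IsOpen U) (hI : IsOpen I) :
    IsNullGeodesic h U Γ I := by
  have hp : ∀ s ∈ I, metricAt h (Γ s).1 (fiberVector (Γ s)) (fiberVector (Γ s)) = 1 :=
    fun s hs => (hΓ.1.2 s hs).1
  have hL : ∀ s ∈ I, liftVelocity Γ s = r • (rotatedX o (Γ s) (z s) + fieldZ o (Γ s)) :=
    fun s hs => (hΓ.2 s hs).1.trans (smul_fieldW_fst o r _ _)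
  have hr : ∀ s ∈ I, metricAt h (Γ s).1 (vertical h (Γ s) (liftVelocity Γ s))
      (rotAt o (Γ s).1 (fiberVector (Γ s))) = r := fun s hs => by
    rw [hL s hs, map_smul, vertical_nullVector, map_smul, smul_apply,
      metricAt_rotAt o (hΓ.1.2 s hs).2, hp s hs, smul_eq_mul, mul_one]
  have ha : ∀ s ∈ I, metricAt h (Γ s).1 (liftVelocity Γ s).1 (fiberVector (Γ s))
      = r * (z s : ℂ).re := fun s hs => by
    rw [hL s hs, Prod.smul_fst, nullVector_fst]
    simp [hp s hs, inner_rotAt_self o (hΓ.1.2 s hs).2]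
  have hb : ∀ s ∈ I, metricAt h (Γ s).1 (liftVelocity Γ s).1
      (rotAt o (Γ s).1 (fiberVector (Γ s))) = r * (z s : ℂ).im := fun s hs => by
    rw [hL s hs, Prod.smul_fst, nullVector_fst]
    simp [hp s hs, inner_self_rotAt o (hΓ.1.2 s hs).2, metricAt_rotAt o (hΓ.1.2 s hs).2]
  refine ⟨hΓ.1, fun t ht => ?_, fun t ht => ?_⟩
  · obtain ⟨h1, h2, h3⟩ := hΓ.1.eventually hI ht
    obtain ⟨α, hα⟩ := exists_isAngleAt h1.self_of_nhds h2
    refine (geodesicEquationAt_iff h1.self_of_nhds).2 ⟨α, hα, ?_, ?_⟩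
    · have hε := (orientationSign_spec o h3.self_of_nhds (mem_chart_source Plane (Γ t).1)).1
      -- The vertical component of rW is the constant r, so the angular velocity is ε r near t.
      have h4 : chartAngularVelocity h Γ t α =ᶠ[𝓝 t]
          fun _ => orientationSign o (Γ t).1 (Γ t).1 * r := by
        filter_upwards [hα.eventually_components o hU h1 h3, hI.eventually_mem ht] with s hs hs'
        have h5 := hs.1
        rw [hr s hs'] at h5
        rw [h5]
        linear_combination -(chartAngularVelocity h Γ t α s) * hε
      rw [h4.deriv_eq, deriv_const]
    · have hz := (hΓ.2 t ht).2
      have hre := (Complex.reCLM.hasFDerivAt.comp_hasDerivAt t hz).const_mul r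
      have him := (Complex.imCLM.hasFDerivAt.comp_hasDerivAt t hz).const_mul r
      refine (hα.acceleration_eq_iff hU h1 h3 (hr t ht)).2 ⟨?_, ?_⟩
      · refine (hre.congr_of_eventuallyEq ((hI.eventually_mem ht).mono ha)).congr_deriv ?_
        rw [smul_fieldW_snd, hb t ht]
        simp
        ring
      · refine (him.congr_of_eventuallyEq ((hI.eventually_mem ht).mono hb)).congr_deriv ?_
        rw [smul_fieldW_snd, ha t ht]
        simp
        ring
  · rw [hL t ht]
    simp only [map_smul, smul_apply, smul_eq_mul, dg_nullVector o (hp t ht) (hΓ.1.2 t ht).2,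
      mul_zero]

theorem IsIntegralCurveW.span_liftVelocity {I : Set ℝ} {r : ℝ} {z : ℝ → Circle} (hr0 : r ≠ 0)
    (hΓ : IsIntegralCurveW o r Γ z I) (ht : t ∈ I) :
    Submodule.span ℝ {liftVelocity Γ t} = nullLine o (Γ t) (z t) := by
  rw [(hΓ.2 t ht).1, smul_fieldW_fst, span_smul_nullVector o hr0]

end NullGeodesics

end MagneticExtension

end

theorem proposition4p10 {S : Type*} [TopologicalSpace S] [ChartedSpace Plane S]
    [IsManifold (𝓡 2) ∞ S] (h : SurfaceMetric S) :
    -- every null-geodesic projects to a curve of constant speed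
    (∀ (Γ : ℝ → TangentBundle (𝓡 2) S) (I : Set ℝ), IsOpen I → IsPreconnected I →
      IsNullGeodesic h Set.univ Γ I →
      ∃ c : ℝ, ∀ t ∈ I, speed h (fun s => (Γ s).1) t = c) ∧
    -- geodesic curvature and natural lifts, over any oriented open subset `U` of the surface
    (∀ (U : Set S), IsOpen U → ∀ o : OrientationOn h U,
      -- the identification of `V × S¹` with `NC(TV)`
      (∀ p ∈ unitTangent h, p.1 ∈ U → Set.BijOn (nullLine o p) Set.univ (nullCircle h p)) ∧
      -- the natural lift to `V × S¹` of a non-constant null-geodesic is an integral curve of `r W`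
      -- for a constant `r ≠ 0`, in particular the null-geodesic has velocity `r (X(θ) + Z)`; its
      -- projection has speed `|r|` and geodesic curvature `-κ` if `r > 0`, and `κ` if `r < 0`
      (∀ (Γ : ℝ → TangentBundle (𝓡 2) S) (I : Set ℝ), IsOpen I → IsPreconnected I →
        IsNullGeodesic h U Γ I → (∃ t ∈ I, liftVelocity Γ t ≠ 0) →
        ∃ (r : ℝ) (z : ℝ → Circle), r ≠ 0 ∧
          (∀ t ∈ I, Submodule.span ℝ {liftVelocity Γ t} = nullLine o (Γ t) (z t)) ∧
          IsIntegralCurveW o r Γ z I ∧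
          ∀ t ∈ I, speed h (fun s => (Γ s).1) t = |r| ∧
            (0 < r → geodesicCurvature h o (fun s => (Γ s).1) t = - gaussCurvature h (Γ t).1) ∧
            (r < 0 → geodesicCurvature h o (fun s => (Γ s).1) t = gaussCurvature h (Γ t).1)) ∧
      -- conversely, integral curves of `r W` are the natural lifts of null-geodesics
      (∀ (r : ℝ), r ≠ 0 → ∀ (Γ : ℝ → TangentBundle (𝓡 2) S) (z : ℝ → Circle) (I : Set ℝ),
        IsOpen I → IsIntegralCurveW o r Γ z I →
        IsNullGeodesic h U Γ I ∧
          ∀ t ∈ I, Submodule.span ℝ {liftVelocity Γ t} = nullLine o (Γ t) (z t))) := by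
  refine ⟨fun Γ I hI hI' hΓ => hΓ.exists_speed_eq hI hI', fun U hU o =>
    ⟨fun p hp hpU => bijOn_nullLine o hp hpU, fun Γ I hI hI' hΓ hne => ?_,
      fun r hr0 Γ z I hI hΓ => ⟨hΓ.isNullGeodesic o hU hI, fun t ht =>
        hΓ.span_liftVelocity o hr0 ht⟩⟩⟩
  obtain ⟨r, hr⟩ := hΓ.exists_vertical_eq o hU hI hI'
  have hT : ∀ t ∈ I, liftVelocity Γ t ∈ unitTangentSpace h (Γ t) := fun t ht =>
    liftVelocity_mem_unitTangentSpace (hΓ.1.eventually hI ht).1 (hΓ.1.eventually hI ht).2.1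
  -- As r is the same at all times, one time with nonzero velocity is enough to exclude r = 0.
  have hr0 : r ≠ 0 := fun h0 => by
    obtain ⟨t, ht, hne⟩ := hne
    exact hne (eq_zero_of_null o (hΓ.1.2 t ht).1 (hΓ.1.2 t ht).2 (hT t ht) (hΓ.2.2 t ht)
      ((hr t ht).trans h0))
  have hW := hΓ.isIntegralCurveW o hU hI hr0 hr
  refine ⟨r, _, hr0, fun t ht => hW.span_liftVelocity o hr0 ht, hW, fun t ht => ?_⟩
  obtain ⟨h1, -, h3⟩ := hΓ.1.eventually hI ht
  have hspeed : metricAt h (Γ t).1 (liftVelocity Γ t).1 (liftVelocity Γ t).1 = r ^ 2 := by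
    rw [inner_self_of_null o (hΓ.1.2 t ht).1 (hΓ.1.2 t ht).2 (hT t ht) (hΓ.2.2 t ht), hr t ht]
  have hk := (hΓ.2.1 t ht).geodesicCurvature_eq o hU h1 h3 hr0 (hr t ht) hspeed
  refine ⟨?_, fun hpos => ?_, fun hneg => ?_⟩
  · rw [speed_eq h1.self_of_nhds, hspeed, Real.sqrt_sq_eq_abs]
  · rw [hk, abs_of_pos hpos, div_self hr0, mul_one]
  · rw [hk, abs_of_neg hneg, div_neg, div_self hr0, mul_neg, mul_one, neg_neg]
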